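/- For $k\in\mathbb N$, a continuous $g:[a,b]\to\mathbb R$ and $t\ge 0$, let $$\omega_k(g,t,[a,b]):=\sup_{0<u\le t}\ \sup_{x\in[a,b]}|\Delta^k_u(g,x;[a,b])|$$ be the $k$-th modulus of smoothness of $g$ (with $\omega_k(g,0,[a,b])=0$), where $\Delta^k_u(g,x;[a,b]):=\sum_{i=0}^k(-1)^i\binom ki g\big(x+(k/2-i)u\big)$ if $x\pm(k/2)u\in[a,b]$, and $\Delta^k_u(g,x;[a,b]):=0$ otherwise. Let $m\in\mathbb N$ and $0<\lambda\le 1$. There are positive constants $C_1,C_2,C_3$, depending only on $m$ and $\lambda$, such that the following holds for all integers $r\ge 0$ and $\mu\ge 1$ with $m=(r+1)(\mu+1)$. Let $Z=\{z_0<z_1<\dots<z_\mu\}\subset\mathbb R$, put $I:=[z_0,z_\mu]$ and $|I|:=z_\mu-z_0$, and suppose that $$z_{j+1}-z_j\ge\lambda|I|\qquad\text{for all }0\le j\le\mu-1 .$$ Let $f\in C^{(r)}(I)$ (derivatives at the end points of $I$ being one-sided). Then there is exactly one polynomial $\mathcal L=\mathcal L(\cdot;f;Z)$ of degree at most $m-1$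 such that $\mathcal L^{(j)}(z_\nu)=f^{(j)}(z_\nu)$ for all $0\le\nu\le\mu$ and $0\le j\le r$, and for every $x\in I$, with $\delta:=\mathrm{dist}(x,Z)=\min_{0\le j\le\mu}|x-z_j|$, $$|f(x)-\mathcal L(x)|\ \le\ C_1\,\delta^{\,r+1}\int_{\delta}^{2|I|}\frac{\omega_{m-r}(f^{(r)},t,I)}{t^2}\,dt\ \le\ C_2\,\delta^{\,r}\,\omega_{m-r}\Big(f^{(r)},\,|I|\,(\delta/|I|)^{1/(m-r)},\,I\Big)\ \le\ C_3\,\delta^{\,r}\,\omega_{m-r}\big(f^{(r)},|I|,I\big).$$ If $\delta>0$, the integrand is integrable on $[\delta,2|I|]$; if $\delta=0$, the second expression is read as $0$. Here $\delta^0:=1$, also for $\delta=0$. -/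

import Mathlib

/-- The `k`-th symmetric difference `Δ^k_u(g, x; [a, b])`: the sum
`∑ (-1)^i (k choose i) g(x + (k/2 - i) u)` if both `x ± (k/2) u` lie in `[a, b]`,
and `0` otherwise. -/
noncomputable def symmetricDifference (k : ℕ) (u : ℝ) (g : ℝ → ℝ) (x a b : ℝ) : ℝ :=
  open Classical in
  if x - (k : ℝ) / 2 * u ∈ Set.Icc a b ∧ x + (k : ℝ) / 2 * u ∈ Set.Icc a b then
    ∑ i ∈ Finset.range (k + 1),
      (-1 : ℝ) ^ i * (k.choose i : ℝ) * g (x + ((k : ℝ) / 2 - (i : ℝ)) * u)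
  else 0

/-- The `k`-th modulus of smoothness `ω_k(g, t; [a, b])`, the supremum over `0 < u ≤ t` of the
uniform norm of `Δ^k_u(g, ·; [a, b])` on `[a, b]`. The set is bounded when `g` is continuous on
`[a, b]`; for `t = 0` it is empty and the value is `0`. -/
noncomputable def modulusOfSmoothness (k : ℕ) (g : ℝ → ℝ) (t a b : ℝ) : ℝ :=
  sSup {y : ℝ | ∃ u ∈ Set.Ioc 0 t, ∃ x ∈ Set.Icc a b, y = |symmetricDifference k u g x a b|}

/-- `P` has degree at most `(r + 1) (μ + 1) - 1`, and `P^{(j)}(z_ν) = f^{(j)}(z_ν)` for all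
`0 ≤ ν ≤ μ` and `0 ≤ j ≤ r`. The derivatives of `f` are taken within the interval `[z_0, z_μ]`
(hence one-sided at its end points). -/
def IsHermitePolynomial (r μ : ℕ) (z : Fin (μ + 1) → ℝ) (f : ℝ → ℝ) (P : Polynomial ℝ) : Prop :=
  P.degree < (((r + 1) * (μ + 1) : ℕ) : WithBot ℕ) ∧
    ∀ ν : Fin (μ + 1), ∀ j : ℕ, j ≤ r →
      (Polynomial.derivative^[j] P).eval (z ν) =
        iteratedDerivWithin j f (Set.Icc (z 0) (z (Fin.last μ))) (z ν)

/-! Write `k = m - r`, `l = b - a`, `ω = ω_k(f^(r), ·)`. Existence and uniqueness come from counting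
roots with multiplicity, and the estimate reduces to the `r`-th derivative. Near the closest node
`z_ν` the error `f - L` has `r + 1` vanishing derivatives (orders `0` to `r`), so a bound `C δ ∫
ω(t)/t²` for `f^(r) - L^(r)` on the `δ`-ball around `z_ν` gives the first inequality after `r`
integrations (`abs_le_mul_pow_of_chain`).

To get that bound, Whitney's inequality (`exists_isWhitneyConstant`) supplies `Q` of degree `< k`
with `|f^(r) - Q| ≤ W₀ ω(l)`. Let `P` be an `r`-fold antiderivative of `Q` with matching Taylor data
at `a`. Since `f^(r) - L^(r)` vanishes at `z_ν`, it is a difference of two increments from `z_ν`.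
The increment of `f^(r) - Q` is controlled by a Marchaud-type inequality
(`abs_sub_sub_le_integral`): compare Whitney polynomials on successively halved intervals, and let
Markov's inequality turn each comparison into one dyadic piece of the integral. The increment of `(L
- P)^(r)` is controlled by Markov's inequality once this polynomial is known to be `O(ω(l))`. That
follows because `L - P` has small Hermite data at the nodes, and Hermite interpolation at separated
nodes is stable by compactness (`exists_norm_coeffs_le`).

The second inequality splits the integral at `s = l (δ/l)^(1/k)`, using monotonicity of `ω` below
`s` and `ω(t) ≤ (2t/s)^k ω(s)` above. The third is monotonicity of `ω`. -/

open Set Polynomial MeasureTheory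

/-! ### Finite differences and moduli of smoothness -/

/-- `W` bounds all `k`-th forward differences of `g` whose nodes lie in `[a, b]` and whose step is
at most `t`. -/
def ForwardDifferenceBound (k : ℕ) (g : ℝ → ℝ) (t a b W : ℝ) : Prop :=
  ∀ y u : ℝ, 0 < u → u ≤ t → a ≤ y → y + k * u ≤ b → |(fwdDiff u)^[k] g y| ≤ W

theorem fwdDiff_iter_eq_sum_real (k : ℕ) (u : ℝ) (g : ℝ → ℝ) (y : ℝ) :
    (fwdDiff u)^[k] g y =
      ∑ i ∈ Finset.range (k + 1), (-1 : ℝ) ^ (k - i) * (k.choose i : ℝ) * g (y + i * u) := by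
  rw [fwdDiff_iter_eq_sum_shift]
  refine Finset.sum_congr rfl fun i _ => ?_
  simp [zsmul_eq_mul]

theorem abs_fwdDiff_iter_le {k : ℕ} {u : ℝ} {g : ℝ → ℝ} {y B : ℝ}
    (h : ∀ i ≤ k, |g (y + i * u)| ≤ B) : |(fwdDiff u)^[k] g y| ≤ 2 ^ k * B := by
  rw [fwdDiff_iter_eq_sum_real]
  refine (Finset.abs_sum_le_sum_abs _ _).trans ?_
  calc ∑ i ∈ Finset.range (k + 1), |(-1 : ℝ) ^ (k - i) * (k.choose i : ℝ) * g (y + i * u)|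
      ≤ ∑ i ∈ Finset.range (k + 1), (k.choose i : ℝ) * B := by
        refine Finset.sum_le_sum fun i hi => ?_
        rw [abs_mul, abs_mul, abs_pow, abs_neg, abs_one, one_pow, one_mul, Nat.abs_cast]
        exact mul_le_mul_of_nonneg_left (h i (by simpa [Nat.lt_succ_iff] using hi)) (by positivity)
    _ = 2 ^ k * B := by
        rw [← Finset.sum_mul]
        congr 1
        exact_mod_cast Nat.sum_range_choose k

theorem symmetricDifference_eq_fwdDiff {k : ℕ} {u x a b : ℝ} (g : ℝ → ℝ)
    (h : x - (k : ℝ) / 2 * u ∈ Icc a b ∧ x + (k : ℝ) / 2 * u ∈ Icc a b) :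
    symmetricDifference k u g x a b = (fwdDiff u)^[k] g (x - (k : ℝ) / 2 * u) := by
  rw [symmetricDifference, if_pos h, fwdDiff_iter_eq_sum_real, ← Finset.sum_range_reflect]
  refine Finset.sum_congr rfl fun i hi => ?_
  have hi' : i ≤ k := by simpa [Nat.lt_succ_iff] using hi
  rw [show k + 1 - 1 - i = k - i by omega, Nat.choose_symm hi', Nat.cast_sub hi']
  congr 2
  ring

theorem modulusOfSmoothness_le {k : ℕ} {g : ℝ → ℝ} {t a b W : ℝ} (hW : 0 ≤ W)
    (h : ForwardDifferenceBound k g t a b W) : modulusOfSmoothness k g t a b ≤ W := by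
  refine Real.sSup_le ?_ hW
  rintro _ ⟨u, hu, x, hx, rfl⟩
  by_cases hc : x - (k : ℝ) / 2 * u ∈ Icc a b ∧ x + (k : ℝ) / 2 * u ∈ Icc a b
  · rw [symmetricDifference_eq_fwdDiff g hc]
    exact h _ _ hu.1 hu.2 hc.1.1 (by linarith [hc.2.2])
  · rw [symmetricDifference, if_neg hc, abs_zero]
    exact hW

theorem modulusOfSmoothness_nonneg (k : ℕ) (g : ℝ → ℝ) (t a b : ℝ) :
    0 ≤ modulusOfSmoothness k g t a b := by
  refine Real.sSup_nonneg ?_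
  rintro _ ⟨u, hu, x, hx, rfl⟩
  exact abs_nonneg _

/-- Needed because the real `sSup` of an unbounded set is `0`; boundedness makes the modulus a
genuine upper bound. -/
theorem bddAbove_symmetricDifference (k : ℕ) {g : ℝ → ℝ} {a b : ℝ} (t : ℝ)
    (hg : ContinuousOn g (Icc a b)) :
    BddAbove {y : ℝ | ∃ u ∈ Ioc 0 t, ∃ x ∈ Icc a b, y = |symmetricDifference k u g x a b|} := by
  obtain ⟨B, hB⟩ := isCompact_Icc.exists_bound_of_continuousOn hg
  refine ⟨2 ^ k * max B 0, ?_⟩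
  rintro _ ⟨u, hu, x, hx, rfl⟩
  by_cases hc : x - (k : ℝ) / 2 * u ∈ Icc a b ∧ x + (k : ℝ) / 2 * u ∈ Icc a b
  · rw [symmetricDifference_eq_fwdDiff g hc]
    refine abs_fwdDiff_iter_le fun i hi => (hB _ ⟨?_, ?_⟩).trans (le_max_left _ _)
    · have := hu.1
      nlinarith [hc.1.1, show (0 : ℝ) ≤ i * u by positivity]
    · have : (i : ℝ) * u ≤ k * u := mul_le_mul_of_nonneg_right (by exact_mod_cast hi) hu.1.le
      linarith [hc.2.2]
  · rw [symmetricDifference, if_neg hc, abs_zero]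
    positivity

theorem forwardDifferenceBound_modulusOfSmoothness (k : ℕ) {g : ℝ → ℝ} {a b : ℝ} (t : ℝ)
    (hg : ContinuousOn g (Icc a b)) :
    ForwardDifferenceBound k g t a b (modulusOfSmoothness k g t a b) := by
  intro y u hu hut hy hyb
  have hku : 0 ≤ (k : ℝ) * u := by positivity
  have hc : y + k / 2 * u - (k : ℝ) / 2 * u ∈ Icc a b ∧
      y + k / 2 * u + (k : ℝ) / 2 * u ∈ Icc a b :=
    ⟨⟨by linarith, by linarith⟩, ⟨by linarith, by linarith⟩⟩
  refine le_csSup (bddAbove_symmetricDifference k t hg)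
    ⟨u, ⟨hu, hut⟩, y + k / 2 * u, ⟨by linarith, by linarith⟩, ?_⟩
  rw [symmetricDifference_eq_fwdDiff g hc, add_sub_cancel_right]

theorem modulusOfSmoothness_mono (k : ℕ) {g : ℝ → ℝ} {a b : ℝ}
    (hg : ContinuousOn g (Icc a b)) : Monotone fun t => modulusOfSmoothness k g t a b := by
  intro s t hst
  refine modulusOfSmoothness_le (modulusOfSmoothness_nonneg _ _ _ _ _) fun y u hu hus hy hyb => ?_
  exact forwardDifferenceBound_modulusOfSmoothness k t hg y u hu (hus.trans hst) hy hyb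

theorem fwdDiff_natCast_mul (φ : ℝ → ℝ) (u : ℝ) (n : ℕ) (y : ℝ) :
    fwdDiff (n * u) φ y = ∑ i ∈ Finset.range n, fwdDiff u φ (y + i * u) := by
  have h := Finset.sum_range_sub (fun i : ℕ => φ (y + i * u)) n
  simp only [fwdDiff]
  rw [Nat.cast_zero, zero_mul, add_zero] at h
  rw [← h]
  refine Finset.sum_congr rfl fun i _ => ?_
  push_cast
  ring_nf

theorem fwdDiff_comm (φ : ℝ → ℝ) (u v : ℝ) :
    fwdDiff u (fwdDiff v φ) = fwdDiff v (fwdDiff u φ) := by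
  funext y
  simp only [fwdDiff]
  rw [add_right_comm]
  ring

theorem fwdDiff_iter_comm (φ : ℝ → ℝ) (u v : ℝ) (n : ℕ) :
    fwdDiff u ((fwdDiff v)^[n] φ) = (fwdDiff v)^[n] (fwdDiff u φ) :=
  (Function.Commute.iterate_right (f := fwdDiff (G := ℝ) u) (g := fwdDiff v)
    (fun φ => fwdDiff_comm φ u v) n) φ

/-- A difference of step `nu` is a sum of `n` shifted differences of step `u`. The factors of the
`k`-th difference are exchanged one at a time, each costing a factor `n`; `key` keeps track of the
mixed differences. -/
theorem ForwardDifferenceBound.nat_mul {k n : ℕ} {g : ℝ → ℝ} {t a b W : ℝ} (hn : 1 ≤ n)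
    (h : ForwardDifferenceBound k g t a b W) :
    ForwardDifferenceBound k g (n * t) a b ((n : ℝ) ^ k * W) := by
  have hn0 : (0 : ℝ) < n := by exact_mod_cast hn
  have key : ∀ u : ℝ, 0 < u → u ≤ t → ∀ j ≤ k, ∀ y : ℝ, a ≤ y →
      y + (j * n + (k - j)) * u ≤ b →
      |(fwdDiff (n * u))^[j] ((fwdDiff u)^[k - j] g) y| ≤ (n : ℝ) ^ j * W := by
    intro u hu hut j
    induction j with
    | zero =>
      intro _ y hy hyb
      have := h y u hu hut hy (by simpa using hyb)
      simpa using this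
    | succ j ih =>
      intro hj y hy hyb
      rw [Function.iterate_succ_apply', fwdDiff_natCast_mul]
      refine (Finset.abs_sum_le_sum_abs _ _).trans ?_
      have hterm : ∀ i ∈ Finset.range n,
          |fwdDiff u ((fwdDiff (n * u))^[j] ((fwdDiff u)^[k - (j + 1)] g)) (y + i * u)| ≤
            (n : ℝ) ^ j * W := by
        intro i hi
        have hin : (i : ℝ) + 1 ≤ n := by exact_mod_cast Finset.mem_range.mp hi
        rw [fwdDiff_iter_comm, ← Function.iterate_succ_apply' (fwdDiff u),
          show (k - (j + 1)).succ = k - j by omega]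
        refine ih (by omega) _ (by nlinarith [show (0 : ℝ) ≤ i * u by positivity]) ?_
        push_cast at hyb
        nlinarith
      refine (Finset.sum_le_sum hterm).trans (le_of_eq ?_)
      simp only [Finset.sum_const, Finset.card_range, nsmul_eq_mul]
      ring
  intro y u hu hut hy hyb
  have hnu : (n : ℝ) * (u / n) = u := by field_simp
  have := key (u / n) (by positivity) (by rw [div_le_iff₀ hn0]; linarith) k le_rfl y hy
    (by rw [sub_self, add_zero, mul_assoc, hnu]; exact hyb)
  simpa [hnu] using this

/-- Enlarge `t` to the multiple `⌈t / s⌉ s` of `s`; the ceiling is at most `t / s + 1 ≤ 2t / s`. -/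
theorem modulusOfSmoothness_le_pow (k : ℕ) {g : ℝ → ℝ} {a b s t : ℝ}
    (hg : ContinuousOn g (Icc a b)) (hs : 0 < s) (hst : s ≤ t) :
    modulusOfSmoothness k g t a b ≤ (2 * t / s) ^ k * modulusOfSmoothness k g s a b := by
  have h1 : 1 ≤ t / s := (one_le_div hs).2 hst
  have hn : 1 ≤ ⌈t / s⌉₊ := Nat.one_le_ceil_iff.2 (by linarith)
  have hc : (⌈t / s⌉₊ : ℝ) ≤ 2 * t / s := by
    have := Nat.ceil_lt_add_one (show 0 ≤ t / s by linarith)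
    rw [mul_div_assoc]; linarith
  have ht : t ≤ ⌈t / s⌉₊ * s := (div_le_iff₀ hs).1 (Nat.le_ceil _)
  have h0 := modulusOfSmoothness_nonneg k g s a b
  calc modulusOfSmoothness k g t a b ≤ modulusOfSmoothness k g (⌈t / s⌉₊ * s) a b :=
        modulusOfSmoothness_mono k hg ht
    _ ≤ (⌈t / s⌉₊ : ℝ) ^ k * modulusOfSmoothness k g s a b :=
        modulusOfSmoothness_le (by positivity)
          ((forwardDifferenceBound_modulusOfSmoothness k s hg).nat_mul hn)
    _ ≤ _ := by gcongr

/-! ### Polynomial antiderivatives and Taylor estimates -/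

theorem exists_polynomial_derivative_eq {n : ℕ} (Q : ℝ[X]) (hQ : Q.degree < n) (a c : ℝ) :
    ∃ P : ℝ[X], P.degree < ((n + 1 : ℕ) : WithBot ℕ) ∧ derivative P = Q ∧ P.eval a = c := by
  set P₀ : ℝ[X] := ∑ i ∈ Finset.range n, monomial (i + 1) (Q.coeff i / (i + 1)) with hP₀
  have hdeg : P₀.degree < ((n + 1 : ℕ) : WithBot ℕ) := by
    rw [← mem_degreeLT]
    refine Submodule.sum_mem _ fun i hi => ?_
    rw [mem_degreeLT]
    refine (degree_monomial_le _ _).trans_lt ?_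
    exact_mod_cast Nat.succ_lt_succ (Finset.mem_range.1 hi)
  have hder : derivative P₀ = Q := by
    ext j
    rw [hP₀, derivative_sum, finsetSum_coeff]
    simp only [derivative_monomial, Nat.add_sub_cancel, coeff_monomial]
    rw [Finset.sum_ite_eq']
    split_ifs with hj
    · push_cast
      field_simp
    · rw [Finset.mem_range, not_lt] at hj
      exact (coeff_eq_zero_of_degree_lt (hQ.trans_le (by exact_mod_cast hj))).symm
  refine ⟨P₀ + C (c - P₀.eval a), ?_, by simp [hder], by simp⟩
  refine (degree_add_le _ _).trans_lt (max_lt hdeg (degree_C_le.trans_lt ?_))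
  exact_mod_cast n.succ_pos

theorem exists_polynomial_iterate_derivative_eq {n : ℕ} (Q : ℝ[X]) (hQ : Q.degree < n) (a : ℝ)
    (r : ℕ) (c : ℕ → ℝ) :
    ∃ P : ℝ[X], P.degree < ((n + r : ℕ) : WithBot ℕ) ∧ derivative^[r] P = Q ∧
      ∀ j < r, (derivative^[j] P).eval a = c j := by
  induction r generalizing c with
  | zero => exact ⟨Q, hQ, rfl, fun j hj => absurd hj (Nat.not_lt_zero j)⟩
  | succ r ih =>
    obtain ⟨P', hdeg', hder', hval'⟩ := ih fun j => c (j + 1)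
    obtain ⟨P, hdeg, hder, hval⟩ := exists_polynomial_derivative_eq P' hdeg' a (c 0)
    refine ⟨P, hdeg, by rw [Function.iterate_succ_apply, hder, hder'], fun j hj => ?_⟩
    cases j with
    | zero => exact hval
    | succ j => rw [Function.iterate_succ_apply, hder, hval' j (by omega)]

/-- Taylor's estimate for a chain of functions `G 0, …, G r`, each the derivative of the previous
one, of which all but the last vanish at `c`. -/
theorem abs_le_mul_pow_of_chain {r : ℕ} {s : Set ℝ} (hs : Convex ℝ s) {G : ℕ → ℝ → ℝ}
    (hG : ∀ j < r, ∀ x ∈ s, HasDerivWithinAt (G j) (G (j + 1) x) s x) {c E : ℝ} (hc : c ∈ s)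
    (hzero : ∀ j < r, G j c = 0) (hE : ∀ x ∈ s, |G r x| ≤ E) {j : ℕ} (hj : j ≤ r) :
    ∀ x ∈ s, |G j x| ≤ E * |x - c| ^ (r - j) := by
  have hE0 : 0 ≤ E := (abs_nonneg _).trans (hE c hc)
  suffices H : ∀ i ≤ r, ∀ x ∈ s, |G (r - i) x| ≤ E * |x - c| ^ i by
    have := H (r - j) (Nat.sub_le _ _)
    rwa [Nat.sub_sub_self hj] at this
  intro i
  induction i with
  | zero => intro _ x hx; simpa using hE x hx
  | succ i ih =>
    intro hi x hx
    have hlt : r - (i + 1) < r := by omega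
    -- On the ball of radius `|x - c|` the previous power bound becomes a constant, so the mean
    -- value inequality applies.
    have hsub : s ∩ Metric.closedBall c |x - c| ⊆ s := inter_subset_left
    have key := (hs.inter (convex_closedBall c |x - c|)).norm_image_sub_le_of_norm_hasDerivWithin_le
      (f := G (r - (i + 1))) (f' := G (r - (i + 1) + 1)) (C := E * |x - c| ^ i) (x := c) (y := x)
      (fun y hy => (hG _ hlt y (hsub hy)).mono hsub)
      (fun y hy => by
        rw [show r - (i + 1) + 1 = r - i by omega, Real.norm_eq_abs]
        refine (ih (by omega) y (hsub hy)).trans ?_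
        have : |y - c| ≤ |x - c| := by simpa [Real.dist_eq] using hy.2
        gcongr)
      ⟨hc, by simp⟩ ⟨hx, by simp [Real.dist_eq]⟩
    rw [hzero _ hlt, sub_zero, Real.norm_eq_abs, Real.norm_eq_abs] at key
    rw [pow_succ, ← mul_assoc]
    exact key

theorem hasDerivWithinAt_iterate_derivative (P : ℝ[X]) (j : ℕ) (s : Set ℝ) (x : ℝ) :
    HasDerivWithinAt (fun x => (derivative^[j] P).eval x) ((derivative^[j + 1] P).eval x) s x := by
  rw [Function.iterate_succ_apply']
  exact ((derivative^[j] P).hasDerivAt x).hasDerivWithinAt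

/-- If the last function of a derivative chain is close to `Q`, the chain is close to the
derivatives of a polynomial `P` with `P^{(r)} = Q`. -/
theorem exists_polynomial_approx_of_chain {n r : ℕ} {s : Set ℝ} (hs : Convex ℝ s)
    {G : ℕ → ℝ → ℝ} (hG : ∀ j < r, ∀ x ∈ s, HasDerivWithinAt (G j) (G (j + 1) x) s x) {c E : ℝ}
    (hc : c ∈ s) {Q : ℝ[X]} (hQ : Q.degree < n) (hE : ∀ x ∈ s, |G r x - Q.eval x| ≤ E) :
    ∃ P : ℝ[X], P.degree < ((n + r : ℕ) : WithBot ℕ) ∧ derivative^[r] P = Q ∧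
      ∀ j ≤ r, ∀ x ∈ s, |G j x - (derivative^[j] P).eval x| ≤ E * |x - c| ^ (r - j) := by
  obtain ⟨P, hdeg, hder, hval⟩ :=
    exists_polynomial_iterate_derivative_eq Q hQ c r fun j => G j c
  refine ⟨P, hdeg, hder, fun j hj => ?_⟩
  refine abs_le_mul_pow_of_chain (G := fun j x => G j x - (derivative^[j] P).eval x) hs
    (fun i hi x hx => (hG i hi x hx).sub (hasDerivWithinAt_iterate_derivative P i s x)) hc
    (fun i hi => ?_) ?_ hj
  · simp [hval i hi]
  · simpa [hder] using hE

/-! ### Steklov means and Whitney's inequality -/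

/-- The mean value of `φ` over the interval with end points `x` and `x + h`. -/
noncomputable def steklovMean (h : ℝ) (φ : ℝ → ℝ) (x : ℝ) : ℝ :=
  ∫ u in (0 : ℝ)..1, φ (x + h * u)

theorem continuous_steklovMean (h : ℝ) {φ : ℝ → ℝ} (hφ : Continuous φ) :
    Continuous (steklovMean h φ) :=
  intervalIntegral.continuous_parametric_intervalIntegral_of_continuous'
    (f := fun x u => φ (x + h * u)) (by fun_prop) 0 1

theorem continuous_steklovMean_iterate (h : ℝ) {φ : ℝ → ℝ} (hφ : Continuous φ) (n : ℕ) :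
    Continuous ((steklovMean h)^[n] φ) := by
  induction n with
  | zero => exact hφ
  | succ n ih =>
    rw [Function.iterate_succ_apply']
    exact continuous_steklovMean h ih

theorem hasDerivAt_steklovMean {h : ℝ} (hh : h ≠ 0) {φ : ℝ → ℝ} (hφ : Continuous φ) (x : ℝ) :
    HasDerivAt (steklovMean h φ) (h⁻¹ * fwdDiff h φ x) x := by
  have heq : steklovMean h φ =
      fun x => h⁻¹ * ((∫ u in (0 : ℝ)..(x + h), φ u) - ∫ u in (0 : ℝ)..x, φ u) := by
    funext y
    rw [intervalIntegral.integral_interval_sub_left (hφ.intervalIntegrable _ _)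
      (hφ.intervalIntegrable _ _), steklovMean, intervalIntegral.integral_comp_add_mul φ hh]
    simp
  rw [heq]
  have h1 : ∀ y, HasDerivAt (fun x => ∫ u in (0 : ℝ)..x, φ u) (φ y) y := fun y =>
    intervalIntegral.integral_hasDerivAt_right (hφ.intervalIntegrable _ _)
      (hφ.stronglyMeasurableAtFilter _ _) hφ.continuousAt
  exact (((h1 (x + h)).comp_add_const x h).sub (h1 x)).const_mul _

theorem hasDerivAt_fwdDiff_iter {ψ ψ' : ℝ → ℝ} (h : ℝ) (hψ : ∀ x, HasDerivAt ψ (ψ' x) x) (j : ℕ)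
    (x : ℝ) : HasDerivAt ((fwdDiff h)^[j] ψ) ((fwdDiff h)^[j] ψ' x) x := by
  induction j generalizing x with
  | zero => exact hψ x
  | succ j ih =>
    rw [Function.iterate_succ_apply', Function.iterate_succ_apply']
    exact ((ih (x + h)).comp_add_const x h).sub (ih x)

/-- Each differentiation trades one mean for a difference quotient, so the `k`-fold mean of `g` has
`k`-th derivative `h⁻ᵏ Δ_h^k g`, which is small when the `k`-th differences are. -/
theorem hasDerivAt_steklovMean_chain {h : ℝ} (hh : h ≠ 0) {g : ℝ → ℝ} (hg : Continuous g)
    {j k : ℕ} (hj : j < k) (x : ℝ) :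
    HasDerivAt (fun x => (h⁻¹) ^ j * (fwdDiff h)^[j] ((steklovMean h)^[k - j] g) x)
      ((h⁻¹) ^ (j + 1) * (fwdDiff h)^[j + 1] ((steklovMean h)^[k - (j + 1)] g) x) x := by
  have hc := continuous_steklovMean_iterate h hg (k - (j + 1))
  have := (hasDerivAt_fwdDiff_iter h (hasDerivAt_steklovMean hh hc) j x).const_mul ((h⁻¹) ^ j)
  rw [← Function.iterate_succ_apply' (steklovMean h),
    show (k - (j + 1)).succ = k - j by omega] at this
  have h2 := congrFun (fwdDiff_iter_const_smul (M := ℝ) (h := h) (h⁻¹)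
    (fwdDiff h ((steklovMean h)^[k - (j + 1)] g)) j) x
  have h3 : (h⁻¹) ^ (j + 1) * (fwdDiff h)^[j + 1] ((steklovMean h)^[k - (j + 1)] g) x =
      (h⁻¹) ^ j * (fwdDiff h)^[j] (h⁻¹ • fwdDiff h ((steklovMean h)^[k - (j + 1)] g)) x := by
    rw [h2, Pi.smul_apply, smul_eq_mul, pow_succ, mul_assoc, Function.iterate_succ_apply]
  rw [h3]
  exact this

/-- Averaging the `k`-th difference of `g` at `x` over its step keeps a bound on it. -/
theorem abs_sum_steklovMean_iterate_le {k : ℕ} {g : ℝ → ℝ} (hg : Continuous g) {h x S W : ℝ}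
    (hh : 0 ≤ h) (hW : ∀ s, 0 ≤ s → s ≤ S → |(fwdDiff s)^[k] g x| ≤ W) (n : ℕ) :
    ∀ s, 0 ≤ s → s + n * h ≤ S →
      |∑ i ∈ Finset.range (k + 1), (-1 : ℝ) ^ (k - i) * (k.choose i : ℝ) *
        (steklovMean (i * h))^[n] g (x + i * s)| ≤ W := by
  induction n with
  | zero =>
    intro s hs hsS
    have := hW s hs (by simpa using hsS)
    rwa [fwdDiff_iter_eq_sum_real] at this
  | succ n ih =>
    intro s hs hsS
    have hint : ∀ i : ℕ, IntervalIntegrable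
        (fun u => (-1 : ℝ) ^ (k - i) * (k.choose i : ℝ) *
          (steklovMean (i * h))^[n] g (x + i * s + i * h * u)) volume 0 1 := fun i => by
      have := continuous_steklovMean_iterate (i * h) hg n
      exact Continuous.intervalIntegrable (by fun_prop) _ _
    have heq : ∑ i ∈ Finset.range (k + 1), (-1 : ℝ) ^ (k - i) * (k.choose i : ℝ) *
          (steklovMean (i * h))^[n + 1] g (x + i * s) =
        ∫ u in (0 : ℝ)..1, ∑ i ∈ Finset.range (k + 1), (-1 : ℝ) ^ (k - i) * (k.choose i : ℝ) *
          (steklovMean (i * h))^[n] g (x + i * s + i * h * u) := by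
      rw [intervalIntegral.integral_finsetSum fun i _ => hint i]
      refine Finset.sum_congr rfl fun i _ => ?_
      rw [Function.iterate_succ_apply', intervalIntegral.integral_const_mul]
      rfl
    rw [heq, ← Real.norm_eq_abs]
    refine (intervalIntegral.norm_integral_le_of_norm_le_const (C := W) fun u hu => ?_).trans
      (by simp)
    rw [uIoc_of_le zero_le_one] at hu
    -- Replacing the step `s` by `s + hu` moves node `i` by `ihu`; this is why the `i`-th term is
    -- averaged over length `ih`.
    have := ih (s + h * u) (by nlinarith [hu.1]) (by push_cast at hsS; nlinarith [hu.2])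
    rw [Real.norm_eq_abs]
    have hx : ∀ i : ℕ, x + i * (s + h * u) = x + i * s + i * h * u := fun i => by ring
    simpa only [hx] using this

theorem ForwardDifferenceBound.nonneg_step {k : ℕ} {g : ℝ → ℝ} {t a b W : ℝ} (hk : k ≠ 0)
    (hW : 0 ≤ W) (h : ForwardDifferenceBound k g t a b W) {y u : ℝ} (hu : 0 ≤ u) (hut : u ≤ t)
    (hy : a ≤ y) (hyb : y + k * u ≤ b) : |(fwdDiff u)^[k] g y| ≤ W := by
  rcases hu.eq_or_lt with rfl | hu
  · obtain ⟨k, rfl⟩ := Nat.exists_eq_succ_of_ne_zero hk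
    rw [Function.iterate_succ_apply']
    simpa [fwdDiff] using hW
  · exact h y u hu hut hy hyb

/-- Averaging `Δ_s^k g(x)` over its step gives an alternating sum bounded by `W`. Its `i = 0` term
is `±g(x)`; for `i ≥ 1` the terms are `k`-fold Steklov means, whose `k`-th derivatives are `O(W)`,
so each is within `O(W)` of its Taylor polynomial at `0`. -/
theorem exists_polynomial_approx_left_half {k : ℕ} (hk : 1 ≤ k) :
    ∃ C : ℝ, 0 ≤ C ∧ ∀ (g : ℝ → ℝ) (W : ℝ), Continuous g → 0 ≤ W →
      ForwardDifferenceBound k g 1 0 1 W →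
      ∃ Q : ℝ[X], Q.degree < k ∧ ∀ x ∈ Icc (0 : ℝ) (1 / 2), |g x - Q.eval x| ≤ C * W := by
  have hk0 : (1 : ℝ) ≤ k := by exact_mod_cast hk
  -- The averaged step reaches `kh` and its last node lies `k · kh = 1/2` to the right of `x ≤ 1/2`,
  -- still in `[0, 1]`.
  set h : ℝ := 1 / (2 * k ^ 2) with hh
  have hhpos : 0 < h := by positivity
  have hkh : (k : ℝ) * (k * h) = 1 / 2 := by rw [hh]; field_simp
  refine ⟨1 + ∑ i ∈ Finset.range k, (k.choose (i + 1) : ℝ) * (h⁻¹) ^ k, by positivity,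
    fun g W hg hW hb => ?_⟩
  have hT : ∀ i ∈ Finset.range k, ∃ T : ℝ[X], T.degree < k ∧ ∀ x ∈ Icc (0 : ℝ) (1 / 2),
      |(steklovMean ((i + 1 : ℕ) * h))^[k] g x - T.eval x| ≤ (h⁻¹) ^ k * W := by
    intro i hi
    have hik : ((i + 1 : ℕ) : ℝ) ≤ k := by exact_mod_cast Finset.mem_range.1 hi
    have hi1 : (1 : ℝ) ≤ ((i + 1 : ℕ) : ℝ) := by exact_mod_cast Nat.succ_pos i
    set η : ℝ := ((i + 1 : ℕ) : ℝ) * h with hη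
    have hηh : h ≤ η := by nlinarith
    have hη0 : 0 < η := hhpos.trans_le hηh
    have hkη : (k : ℝ) * η ≤ 1 / 2 := by
      rw [← hkh, hη]
      gcongr
    -- With `n = 0` and `Q = 0` the polynomial obtained is the Taylor polynomial of degree `< k` at
    -- `0`.
    obtain ⟨T, hT1, -, hT2⟩ := exists_polynomial_approx_of_chain (n := 0) (r := k)
      (s := Icc (0 : ℝ) (1 / 2)) (convex_Icc _ _)
      (G := fun j x => (η⁻¹) ^ j * (fwdDiff η)^[j] ((steklovMean η)^[k - j] g) x)
      (fun j hj x _ => (hasDerivAt_steklovMean_chain hη0.ne' hg hj x).hasDerivWithinAt)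
      (c := 0) (E := (h⁻¹) ^ k * W) (by simp) (Q := 0) (by simp) (fun x hx => by
        have h1 : |(fwdDiff η)^[k] g x| ≤ W :=
          hb x η hη0 (by nlinarith) hx.1 (by linarith [hx.2])
        simp only [Nat.sub_self, Function.iterate_zero, id, eval_zero, sub_zero]
        rw [abs_mul, abs_of_nonneg (by positivity)]
        gcongr)
    refine ⟨T, by simpa using hT1, fun x hx => ?_⟩
    have := hT2 0 (Nat.zero_le _) x hx
    simp only [pow_zero, one_mul, Function.iterate_zero, id, Nat.sub_zero, sub_zero] at this
    refine this.trans (mul_le_of_le_one_right (by positivity) (pow_le_one₀ (abs_nonneg _) ?_))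
    rw [abs_of_nonneg hx.1]
    linarith [hx.2]
  choose! T hTdeg hTle using hT
  have hsq : ((-1 : ℝ) ^ k) * (-1) ^ k = 1 := by rw [← mul_pow]; simp
  refine ⟨C (-(-1) ^ k) * ∑ i ∈ Finset.range k,
    C ((-1 : ℝ) ^ (k - (i + 1)) * (k.choose (i + 1) : ℝ)) * T i, ?_, fun x hx => ?_⟩
  · rw [← mem_degreeLT, ← smul_eq_C_mul]
    refine Submodule.smul_mem _ _ (Submodule.sum_mem _ fun i hi => ?_)
    rw [← smul_eq_C_mul]
    exact Submodule.smul_mem _ _ (mem_degreeLT.2 (hTdeg i hi))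
  · have h1 := abs_sum_steklovMean_iterate_le (k := k) (S := k * h) (W := W) (x := x) hg hhpos.le
      (fun s hs hs' => hb.nonneg_step (by omega) hW hs (by nlinarith) hx.1 (by nlinarith [hx.2]))
      k 0 le_rfl (by simp)
    rw [Finset.sum_range_succ'] at h1
    have hid : (steklovMean 0)^[k] g = g := by
      have : steklovMean 0 g = g := by funext y; simp [steklovMean]
      exact Function.iterate_fixed this k
    simp only [mul_zero, add_zero, Nat.cast_zero, zero_mul, hid, Nat.sub_zero, Nat.choose_zero_right,
      Nat.cast_one, mul_one] at h1
    set A := ∑ i ∈ Finset.range k, (-1 : ℝ) ^ (k - (i + 1)) * (k.choose (i + 1) : ℝ) *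
      (steklovMean ((i + 1 : ℕ) * h))^[k] g x with hA
    set B := ∑ i ∈ Finset.range k, (-1 : ℝ) ^ (k - (i + 1)) * (k.choose (i + 1) : ℝ) *
      (T i).eval x with hB
    have hAB : |A - B| ≤ ∑ i ∈ Finset.range k, (k.choose (i + 1) : ℝ) * ((h⁻¹) ^ k * W) := by
      rw [hA, hB, ← Finset.sum_sub_distrib]
      refine (Finset.abs_sum_le_sum_abs _ _).trans (Finset.sum_le_sum fun i hi => ?_)
      rw [← mul_sub, abs_mul, abs_mul, abs_pow, abs_neg, abs_one, one_pow, one_mul, Nat.abs_cast]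
      exact mul_le_mul_of_nonneg_left (hTle i hi x hx) (by positivity)
    have hQ : (C (-(-1 : ℝ) ^ k) * ∑ i ∈ Finset.range k,
        C ((-1 : ℝ) ^ (k - (i + 1)) * (k.choose (i + 1) : ℝ)) * T i).eval x = -(-1) ^ k * B := by
      rw [eval_mul, eval_C, eval_finsetSum, hB]
      simp
    have habs : |g x - -(-1) ^ k * B| = |(A + (-1) ^ k * g x) - (A - B)| := by
      rw [show (A + (-1) ^ k * g x) - (A - B) = (-1) ^ k * (g x - -(-1) ^ k * B) by
        linear_combination (-B) * hsq, abs_mul, abs_pow, abs_neg, abs_one, one_pow, one_mul]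
    rw [hQ, habs, add_mul, one_mul, Finset.sum_mul]
    refine (abs_sub _ _).trans (add_le_add h1 (hAB.trans (le_of_eq ?_)))
    exact Finset.sum_congr rfl fun i _ => by ring

theorem degree_comp_affine_lt {p : ℝ[X]} {k : ℕ} (hp : p.degree < k) (c l : ℝ) :
    (p.comp (C c + C l * X)).degree < k := by
  by_cases h0 : p.comp (C c + C l * X) = 0
  · rw [h0, degree_zero]
    exact WithBot.bot_lt_coe k
  have hp0 : p ≠ 0 := by
    rintro rfl
    simp at h0
  rw [← natDegree_lt_iff_degree_lt h0]
  have h1 : p.natDegree < k := (natDegree_lt_iff_degree_lt hp0).2 hp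
  have h2 : (C c + C l * X : ℝ[X]).natDegree ≤ 1 := by
    rw [add_comm]
    exact natDegree_linear_le
  have h3 := natDegree_comp_le (p := p) (q := C c + C l * X)
  nlinarith

theorem eval_comp_affine (p : ℝ[X]) (c l t : ℝ) :
    (p.comp (C c + C l * X)).eval t = p.eval (c + l * t) := by
  simp [eval_comp]

theorem fwdDiff_iter_comp_affine (g : ℝ → ℝ) (c l u : ℝ) (k : ℕ) (t : ℝ) :
    (fwdDiff u)^[k] (fun t => g (c + l * t)) t = (fwdDiff (l * u))^[k] g (c + l * t) := by
  rw [fwdDiff_iter_eq_sum_real, fwdDiff_iter_eq_sum_real]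
  refine Finset.sum_congr rfl fun i _ => ?_
  ring_nf

/-- The substitution `x = y + ut` reduces step `u` to step `1`. -/
theorem fwdDiff_iter_polynomial_eq_zero {Q : ℝ[X]} {k : ℕ} (hQ : Q.degree < k) (u y : ℝ) :
    (fwdDiff u)^[k] (fun x => Q.eval x) y = 0 := by
  by_cases h0 : Q.comp (C y + C u * X) = 0
  · have h1 := fwdDiff_iter_comp_affine (fun x => Q.eval x) y u 1 k 0
    simp only [← eval_comp_affine, h0, mul_one, mul_zero, add_zero] at h1
    rw [← h1, fwdDiff_iter_eq_sum_real]
    simp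
  · have h1 := fwdDiff_iter_comp_affine (fun x => Q.eval x) y u 1 k 0
    simp only [mul_one, mul_zero, add_zero, ← eval_comp_affine] at h1
    rw [← h1]
    exact congrFun (Polynomial.fwdDiff_iter_eq_zero_of_degree_lt
      ((natDegree_lt_iff_degree_lt h0).2 (degree_comp_affine_lt hQ y u))) 0

theorem fwdDiff_iter_sub_polynomial (g : ℝ → ℝ) {Q : ℝ[X]} {k : ℕ} (hQ : Q.degree < k) (u y : ℝ) :
    (fwdDiff u)^[k] (fun x => g x - Q.eval x) y = (fwdDiff u)^[k] g y := by
  rw [← sub_zero ((fwdDiff u)^[k] g y), ← fwdDiff_iter_polynomial_eq_zero hQ u y]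
  simp only [fwdDiff_iter_eq_sum_real, mul_sub, Finset.sum_sub_distrib]

/-- A bound on `[0, ρ]` extends to `[0, (1 + 1 / k) ρ]` with the help of the `k`-th difference
with nodes `0, y / k, …, y`. -/
theorem ForwardDifferenceBound.abs_le_of_le_mul {k : ℕ} (hk : 1 ≤ k) {g : ℝ → ℝ} {W B ρ : ℝ}
    (hW : 0 ≤ W) (hB0 : 0 ≤ B) (hρ : 0 ≤ ρ) (h : ForwardDifferenceBound k g 1 0 1 W)
    (hB : ∀ x ∈ Icc (0 : ℝ) 1, x ≤ ρ → |g x| ≤ B) {y : ℝ} (hy : y ∈ Icc (0 : ℝ) 1)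
    (hyρ : y ≤ ρ * (1 + 1 / k)) : |g y| ≤ W + 2 ^ k * B := by
  have hk0 : (1 : ℝ) ≤ k := by exact_mod_cast hk
  have h2 : (1 : ℝ) ≤ 2 ^ k := one_le_pow₀ (by norm_num)
  rcases le_or_gt y ρ with hle | hgt
  · nlinarith [hB y hy hle]
  have hy0 : 0 < y := hρ.trans_lt hgt
  have hku : (k : ℝ) * (y / k) = y := by field_simp
  have hΔ := h 0 (y / k) (by positivity) ((div_le_one (by positivity)).2 (hy.2.trans hk0)) le_rfl
    (by rw [hku, zero_add]; exact hy.2)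
  rw [fwdDiff_iter_eq_sum_real, Finset.sum_range_succ] at hΔ
  simp only [Nat.sub_self, pow_zero, Nat.choose_self, Nat.cast_one, one_mul, zero_add, hku] at hΔ
  have hsum : |∑ i ∈ Finset.range k,
      (-1 : ℝ) ^ (k - i) * (k.choose i : ℝ) * g (i * (y / k))| ≤ 2 ^ k * B := by
    refine (Finset.abs_sum_le_sum_abs _ _).trans ?_
    calc _ ≤ ∑ i ∈ Finset.range k, (k.choose i : ℝ) * B := by
          refine Finset.sum_le_sum fun i hi => ?_
          rw [abs_mul, abs_mul, abs_pow, abs_neg, abs_one, one_pow, one_mul, Nat.abs_cast]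
          have hik : (i : ℝ) + 1 ≤ k := by exact_mod_cast Finset.mem_range.1 hi
          have hpos : 0 ≤ y / k := by positivity
          have hi0 : (0 : ℝ) ≤ i * (y / k) := by positivity
          -- All nodes but the last are at most `y - y/k`, and `(1 + 1/k)(1 - 1/k) ≤ 1`.
          have hile : i * (y / k) ≤ ρ := by
            have h3 : (i : ℝ) * (y / k) ≤ y - y / k := by nlinarith
            have h5 : y - y / k ≤ ρ * (1 + 1 / k) * (1 - 1 / k) := by
              have : y - y / k = y * (1 - 1 / k) := by ring
              rw [this]
              refine mul_le_mul_of_nonneg_right hyρ ?_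
              rw [sub_nonneg, div_le_one (by positivity)]
              exact hk0
            have h6 : ρ * (1 + 1 / k) * (1 - 1 / k) = ρ - ρ * (1 / k) ^ 2 := by ring
            have h7 : 0 ≤ ρ * (1 / (k : ℝ)) ^ 2 := by positivity
            linarith
          refine mul_le_mul_of_nonneg_left (hB _ ⟨hi0, ?_⟩ hile) (by positivity)
          nlinarith [hy.2]
      _ ≤ ∑ i ∈ Finset.range (k + 1), (k.choose i : ℝ) * B := by
          rw [Finset.sum_range_succ]
          have : 0 ≤ (k.choose k : ℝ) * B := by positivity
          linarith
      _ = 2 ^ k * B := by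
          rw [← Finset.sum_mul]
          congr 1
          exact_mod_cast Nat.sum_range_choose k
  rw [abs_le] at hΔ hsum ⊢
  constructor <;> linarith [hΔ.1, hΔ.2, hsum.1, hsum.2]

/-- The half-interval polynomial serves at every stage: subtracting it does not change `k`-th
differences, so the bound on the remainder spreads by a factor `1 + 1/k` each time. -/
theorem exists_polynomial_approx_left {k : ℕ} (hk : 1 ≤ k) (n : ℕ) :
    ∃ C : ℝ, 0 ≤ C ∧ ∀ (g : ℝ → ℝ) (W : ℝ), Continuous g → 0 ≤ W →
      ForwardDifferenceBound k g 1 0 1 W → ∃ Q : ℝ[X], Q.degree < k ∧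
        ∀ x ∈ Icc (0 : ℝ) 1, x ≤ 1 / 2 * (1 + 1 / k) ^ n → |g x - Q.eval x| ≤ C * W := by
  induction n with
  | zero =>
    obtain ⟨C, hC, h⟩ := exists_polynomial_approx_left_half hk
    refine ⟨C, hC, fun g W hg hW hb => ?_⟩
    obtain ⟨Q, hQ, hQle⟩ := h g W hg hW hb
    exact ⟨Q, hQ, fun x hx hx' => hQle x ⟨hx.1, by simpa using hx'⟩⟩
  | succ n ih =>
    obtain ⟨C, hC, h⟩ := ih
    refine ⟨1 + 2 ^ k * C, by positivity, fun g W hg hW hb => ?_⟩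
    obtain ⟨Q, hQ, hQle⟩ := h g W hg hW hb
    refine ⟨Q, hQ, fun x hx hx' => ?_⟩
    have hb' : ForwardDifferenceBound k (fun x => g x - Q.eval x) 1 0 1 W := by
      intro y u hu hut hy hyb
      rw [fwdDiff_iter_sub_polynomial g hQ]
      exact hb y u hu hut hy hyb
    have := hb'.abs_le_of_le_mul hk hW (by positivity) (by positivity) hQle hx
      (by rwa [pow_succ, ← mul_assoc] at hx')
    linarith

/-- `W₀` is an admissible constant in Whitney's inequality for polynomials of degree `< k`. -/
def IsWhitneyConstant (k : ℕ) (W₀ : ℝ) : Prop :=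
  ∀ (g : ℝ → ℝ) (a b W : ℝ), a < b → ContinuousOn g (Icc a b) → 0 ≤ W →
    ForwardDifferenceBound k g (b - a) a b W →
    ∃ Q : ℝ[X], Q.degree < k ∧ ∀ x ∈ Icc a b, |g x - Q.eval x| ≤ W₀ * W

theorem exists_isWhitneyConstant {k : ℕ} (hk : 1 ≤ k) : ∃ W₀, 0 ≤ W₀ ∧ IsWhitneyConstant k W₀ := by
  obtain ⟨W₀, hW₀, h⟩ := exists_polynomial_approx_left hk k
  refine ⟨W₀, hW₀, fun g a b W hab hg hW hb => ?_⟩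
  have hk0 : (1 : ℝ) ≤ k := by exact_mod_cast hk
  have hl : 0 < b - a := sub_pos.2 hab
  -- Steklov means require a function continuous on the whole line.
  set G : ℝ → ℝ := IccExtend hab.le (domRestrict (Icc a b) g) with hG
  have hGc : Continuous G := (continuousOn_iff_continuous_domRestrict.1 hg).Icc_extend'
  have hGg : ∀ x ∈ Icc a b, G x = g x := fun x hx => IccExtend_of_mem _ _ hx
  -- By Bernoulli `(1 + 1/k)^k ≥ 2`, so `k` extension steps carry `[0, 1/2]` to `[0, 1]`.
  have hbern : (1 : ℝ) ≤ 1 / 2 * (1 + 1 / k) ^ k := by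
    have := one_add_mul_le_pow (show (-2 : ℝ) ≤ 1 / k by
      have : (0 : ℝ) ≤ 1 / k := by positivity
      linarith) k
    have h1 : (k : ℝ) * (1 / k) = 1 := by field_simp
    linarith
  obtain ⟨Q, hQ, hQle⟩ := h (fun t => G (a + (b - a) * t)) W (by fun_prop) hW (by
    intro y u hu _ hy hyb
    have hlu : 0 ≤ (b - a) * u := by positivity
    have hly : 0 ≤ (b - a) * y := by positivity
    have hlt : (b - a) * (y + k * u) ≤ b - a := mul_le_of_le_one_right hl.le hyb
    rw [fwdDiff_iter_comp_affine]
    have heq : (fwdDiff ((b - a) * u))^[k] G (a + (b - a) * y) =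
        (fwdDiff ((b - a) * u))^[k] g (a + (b - a) * y) := by
      rw [fwdDiff_iter_eq_sum_real, fwdDiff_iter_eq_sum_real]
      refine Finset.sum_congr rfl fun i hi => ?_
      have hik : (i : ℝ) ≤ k := by
        exact_mod_cast Nat.lt_succ_iff.1 (Finset.mem_range.1 hi)
      have h1 : (0 : ℝ) ≤ i * ((b - a) * u) := by positivity
      rw [hGg _ ⟨by linarith, by nlinarith⟩]
    rw [heq]
    refine hb _ _ (by positivity) ?_ (by linarith) (by nlinarith)
    nlinarith)
  refine ⟨Q.comp (C (-a / (b - a)) + C (1 / (b - a)) * X), degree_comp_affine_lt hQ _ _,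
    fun x hx => ?_⟩
  rw [eval_comp_affine]
  have ht : -a / (b - a) + 1 / (b - a) * x = (x - a) / (b - a) := by ring
  have hx1 : (x - a) / (b - a) ∈ Icc (0 : ℝ) 1 :=
    ⟨div_nonneg (by linarith [hx.1]) hl.le, (div_le_one hl).2 (by linarith [hx.2])⟩
  have := hQle _ hx1 (hx1.2.trans hbern)
  rw [mul_div_cancel₀ _ hl.ne', add_sub_cancel, hGg x hx] at this
  rwa [ht]

/-! ### Markov's inequality -/

/-- `K` is an admissible constant in Markov's inequality for polynomials of degree `< k`, in its
Lipschitz form. -/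
def IsMarkovConstant (k : ℕ) (K : ℝ) : Prop :=
  ∀ (p : ℝ[X]) (a b B : ℝ), p.degree < k → a < b → (∀ x ∈ Icc a b, |p.eval x| ≤ B) →
    ∀ x ∈ Icc a b, ∀ y ∈ Icc a b, |p.eval x - p.eval y| ≤ K * (|x - y| / (b - a)) * B

theorem exists_polynomial_lipschitz (p : ℝ[X]) :
    ∃ K : ℝ, 0 ≤ K ∧ ∀ x ∈ Icc (0 : ℝ) 1, ∀ y ∈ Icc (0 : ℝ) 1,
      |p.eval x - p.eval y| ≤ K * |x - y| := by
  obtain ⟨K, hK⟩ := isCompact_Icc.exists_bound_of_continuousOn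
    (s := Icc (0 : ℝ) 1) (f := fun x => (derivative p).eval x) (by fun_prop)
  refine ⟨K, (norm_nonneg _).trans (hK 0 (by simp)), fun x hx y hy => ?_⟩
  exact (convex_Icc (0 : ℝ) 1).norm_image_sub_le_of_norm_hasDerivWithin_le
    (f := fun x => p.eval x) (fun z _ => (p.hasDerivAt z).hasDerivWithinAt) hK hy hx

/-- Only some constant is needed: expand in the Lagrange basis at the nodes `i / k` of `[0, 1]`,
whose members are Lipschitz there, and rescale. -/
theorem exists_isMarkovConstant {k : ℕ} (hk : 1 ≤ k) : ∃ K, 0 ≤ K ∧ IsMarkovConstant k K := by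
  have hk0 : (1 : ℝ) ≤ k := by exact_mod_cast hk
  set v : ℕ → ℝ := fun i => i / k with hv
  have hvinj : Set.InjOn v (Finset.range k) := by
    intro i _ j _ hij
    have h1 : (i : ℝ) / k = j / k := hij
    rw [div_left_inj' (by positivity)] at h1
    exact_mod_cast h1
  have hv01 : ∀ i ∈ Finset.range k, v i ∈ Icc (0 : ℝ) 1 := by
    intro i hi
    have : (i : ℝ) ≤ k := by exact_mod_cast (Finset.mem_range.1 hi).le
    exact ⟨by positivity, (div_le_one (by positivity)).2 this⟩
  choose K hK0 hK using fun i => exists_polynomial_lipschitz (Lagrange.basis (Finset.range k) v i)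
  have unit : ∀ (p : ℝ[X]) (B : ℝ), p.degree < k → (∀ x ∈ Icc (0 : ℝ) 1, |p.eval x| ≤ B) →
      ∀ x ∈ Icc (0 : ℝ) 1, ∀ y ∈ Icc (0 : ℝ) 1,
        |p.eval x - p.eval y| ≤ (∑ i ∈ Finset.range k, K i) * |x - y| * B := by
    intro p B hp hB x hx y hy
    have heq := Lagrange.eq_interpolate hvinj (f := p) (by simpa using hp)
    rw [Lagrange.interpolate_apply] at heq
    have heval : ∀ t, p.eval t = ∑ i ∈ Finset.range k,
        p.eval (v i) * (Lagrange.basis (Finset.range k) v i).eval t := by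
      intro t
      conv_lhs => rw [heq]
      simp [eval_finsetSum]
    rw [heval x, heval y, ← Finset.sum_sub_distrib, Finset.sum_mul, Finset.sum_mul]
    refine (Finset.abs_sum_le_sum_abs _ _).trans (Finset.sum_le_sum fun i hi => ?_)
    rw [← mul_sub, abs_mul, mul_comm]
    exact mul_le_mul (hK i x hx y hy) (hB _ (hv01 i hi)) (abs_nonneg _)
      (mul_nonneg (hK0 i) (abs_nonneg _))
  refine ⟨∑ i ∈ Finset.range k, K i, Finset.sum_nonneg fun i _ => hK0 i,
    fun p a b B hp hab hB x hx y hy => ?_⟩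
  have hl : 0 < b - a := sub_pos.2 hab
  have hmem : ∀ z ∈ Icc a b, (z - a) / (b - a) ∈ Icc (0 : ℝ) 1 := fun z hz =>
    ⟨div_nonneg (by linarith [hz.1]) hl.le, (div_le_one hl).2 (by linarith [hz.2])⟩
  have hback : ∀ z, a + (b - a) * ((z - a) / (b - a)) = z := fun z => by
    rw [mul_div_cancel₀ _ hl.ne', add_sub_cancel]
  have := unit (p.comp (C a + C (b - a) * X)) B (degree_comp_affine_lt hp _ _)
    (fun t ht => by
      rw [eval_comp_affine]
      exact hB _ ⟨by nlinarith [ht.1], by nlinarith [ht.2]⟩)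
    _ (hmem x hx) _ (hmem y hy)
  rw [eval_comp_affine, eval_comp_affine, hback, hback, ← sub_div, sub_sub_sub_cancel_right,
    abs_div, abs_of_pos hl] at this
  exact this

/-! ### The integral of `ω(t)/t²` and a Marchaud-type inequality -/

theorem intervalIntegrable_div_sq {ω : ℝ → ℝ} (hω : Monotone ω) {s t : ℝ} (hs : 0 < s)
    (hst : s ≤ t) : IntervalIntegrable (fun τ => ω τ / τ ^ 2) volume s t := by
  have hcont : ContinuousOn (fun τ : ℝ => (τ ^ 2)⁻¹) (uIcc s t) := by
    rw [uIcc_of_le hst]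
    refine ContinuousOn.inv₀ (by fun_prop) fun τ hτ => ?_
    have : 0 < τ := hs.trans_le hτ.1
    positivity
  simpa only [div_eq_mul_inv] using (hω.intervalIntegrable (μ := volume)).mul_continuousOn hcont

theorem integral_div_sq_nonneg {ω : ℝ → ℝ} (hω0 : ∀ t, 0 ≤ ω t) {s t : ℝ} (hst : s ≤ t) :
    0 ≤ ∫ τ in s..t, ω τ / τ ^ 2 :=
  intervalIntegral.integral_nonneg hst fun τ _ => div_nonneg (hω0 τ) (sq_nonneg τ)

theorem div_le_integral_div_sq {ω : ℝ → ℝ} (hω : Monotone ω) (hω0 : ∀ t, 0 ≤ ω t) {l : ℝ}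
    (hl : 0 < l) : ω l / (4 * l) ≤ ∫ τ in l..2 * l, ω τ / τ ^ 2 := by
  have h := intervalIntegral.integral_mono_on (μ := volume) (a := l) (b := 2 * l)
    (f := fun _ => ω l / (2 * l) ^ 2)
    (by linarith) (by simp) (intervalIntegrable_div_sq hω hl (by linarith)) fun τ hτ => by
      have hτ0 : 0 < τ := hl.trans_le hτ.1
      have h1 := hω hτ.1
      have h2 := hτ.2
      have h3 := hω0 τ
      gcongr
  rw [intervalIntegral.integral_const, smul_eq_mul] at h
  refine le_trans (le_of_eq ?_) h
  field_simp
  ring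

theorem integral_div_sq_split {ω : ℝ → ℝ} (hω : Monotone ω) {s t u : ℝ} (hs : 0 < s)
    (hst : s ≤ t) (htu : t ≤ u) :
    ∫ τ in s..u, ω τ / τ ^ 2 = (∫ τ in s..t, ω τ / τ ^ 2) + ∫ τ in t..u, ω τ / τ ^ 2 :=
  (intervalIntegral.integral_add_adjacent_intervals (intervalIntegrable_div_sq hω hs hst)
    (intervalIntegrable_div_sq hω (hs.trans_le hst) htu)).symm

/-- Start the half interval at `min x y`, or push it against `e` if it would overshoot. -/
theorem exists_half_interval {c e d x y : ℝ} (hd : d ≤ (e - c) / 2) (hx : x ∈ Icc c e)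
    (hy : y ∈ Icc c e) (hxy : |x - y| ≤ d) :
    ∃ c' e', c ≤ c' ∧ e' ≤ e ∧ e' - c' = (e - c) / 2 ∧ x ∈ Icc c' e' ∧ y ∈ Icc c' e' := by
  have h1 := abs_le.1 hxy
  have hm := le_min hx.1 hy.1
  have hmx := min_le_left x y
  have hmy := min_le_right x y
  have hMx : x ≤ min x y + d := by
    rcases min_choice x y with h | h <;> rw [h] <;> linarith [abs_nonneg (x - y)]
  have hMy : y ≤ min x y + d := by
    rcases min_choice x y with h | h <;> rw [h] <;> linarith [abs_nonneg (x - y)]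
  rcases le_total (min x y) (e - (e - c) / 2) with h | h
  · exact ⟨min x y, min x y + (e - c) / 2, hm, by linarith, by ring, ⟨hmx, by linarith⟩,
      ⟨hmy, by linarith⟩⟩
  · exact ⟨e - (e - c) / 2, e, by linarith [hx.1, hx.2], le_rfl, by ring, ⟨by linarith, hx.2⟩,
      ⟨by linarith, hy.2⟩⟩

/-- A Marchaud-type inequality: polynomials approximating `g` on a sequence of halved intervals
are compared with one another. -/
theorem abs_sub_sub_le_integral_of_le_pow {k : ℕ} {W₀ K : ℝ} (hW₀ : 0 ≤ W₀)
    (hwh : IsWhitneyConstant k W₀) (hK : 0 ≤ K) (hmk : IsMarkovConstant k K) {g : ℝ → ℝ} {a b : ℝ}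
    (hg : ContinuousOn g (Icc a b)) {ω : ℝ → ℝ} (hω : ∀ t, ω t = modulusOfSmoothness k g t a b)
    {d x y : ℝ} (hd : 0 < d) (hxy : |x - y| ≤ d) (n : ℕ) :
    ∀ c e : ℝ, a ≤ c → e ≤ b → d ≤ e - c → e - c ≤ 2 ^ n * d → x ∈ Icc c e → y ∈ Icc c e →
      ∀ Q : ℝ[X], Q.degree < k → (∀ w ∈ Icc c e, |g w - Q.eval w| ≤ W₀ * ω (e - c)) →
      |(g x - Q.eval x) - (g y - Q.eval y)| ≤
        16 * W₀ * (1 + K) * (d * ∫ t in d..2 * (e - c), ω t / t ^ 2) := by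
  have hmono : Monotone ω := by
    have := modulusOfSmoothness_mono k hg
    rwa [← funext hω] at this
  have hω0 : ∀ t, 0 ≤ ω t := fun t => by
    rw [hω]
    exact modulusOfSmoothness_nonneg _ _ _ _ _
  have hlarge : ∀ c e : ℝ, d ≤ e - c → W₀ * ω (e - c) * (d / (e - c)) * 4 ≤
      16 * W₀ * (d * ∫ t in (e - c)..2 * (e - c), ω t / t ^ 2) := by
    intro c e hde
    have hl : 0 < e - c := hd.trans_le hde
    have h1 := div_le_integral_div_sq hmono hω0 hl
    calc W₀ * ω (e - c) * (d / (e - c)) * 4 = 16 * W₀ * (d * (ω (e - c) / (4 * (e - c)))) := by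
          field_simp
          ring
      _ ≤ _ := by gcongr
  -- End of the halving: as `e - c ≤ 2d`, the factor `d / (e - c)` is at least `1/2` and the
  -- triangle inequality suffices.
  have hsmall : ∀ c e : ℝ, d ≤ e - c → e - c ≤ 2 * d → x ∈ Icc c e → y ∈ Icc c e →
      ∀ Q : ℝ[X], (∀ w ∈ Icc c e, |g w - Q.eval w| ≤ W₀ * ω (e - c)) →
      |(g x - Q.eval x) - (g y - Q.eval y)| ≤
        16 * W₀ * (1 + K) * (d * ∫ t in d..2 * (e - c), ω t / t ^ 2) := by
    intro c e hde hed hx hy Q hQ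
    have hl : 0 < e - c := hd.trans_le hde
    have hsplit := integral_div_sq_split hmono hd hde (by linarith : e - c ≤ 2 * (e - c))
    have h1 := integral_div_sq_nonneg hω0 hde
    have h2 := integral_div_sq_nonneg hω0 (by linarith : e - c ≤ 2 * (e - c))
    have h3 : 1 / 2 ≤ d / (e - c) := by rw [div_le_div_iff₀ two_pos hl]; linarith
    have h4 : 0 ≤ W₀ * ω (e - c) := mul_nonneg hW₀ (hω0 _)
    calc |(g x - Q.eval x) - (g y - Q.eval y)| ≤ W₀ * ω (e - c) + W₀ * ω (e - c) :=
          (abs_sub _ _).trans (add_le_add (hQ x hx) (hQ y hy))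
      _ ≤ W₀ * ω (e - c) * (d / (e - c)) * 4 := by nlinarith
      _ ≤ _ := hlarge c e hde
      _ ≤ 16 * W₀ * (d * ∫ t in d..2 * (e - c), ω t / t ^ 2) := by
          rw [hsplit]
          gcongr
          linarith
      _ ≤ _ := by
          refine mul_le_mul_of_nonneg_right ?_ (mul_nonneg hd.le (by rw [hsplit]; positivity))
          nlinarith [mul_nonneg hW₀ hK]
  -- `n` bounds the number of halvings before the length drops to `2d`.
  induction n with
  | zero =>
    intro c e _ _ hde hed hx hy Q _ hQ
    exact hsmall c e hde (by linarith) hx hy Q hQ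
  | succ n ih =>
    intro c e hac heb hde hed hx hy Q hQdeg hQ
    rcases le_or_gt (e - c) (2 * d) with hle | hgt
    · exact hsmall c e hde hle hx hy Q hQ
    have hl : 0 < e - c := hd.trans_le hde
    obtain ⟨c', e', hcc, hee, hlen, hx', hy'⟩ :=
      exists_half_interval (by linarith : d ≤ (e - c) / 2) hx hy hxy
    have hsub : Icc c' e' ⊆ Icc a b := Icc_subset_Icc (hac.trans hcc) (hee.trans heb)
    obtain ⟨Q', hQ'deg, hQ'⟩ := hwh g c' e' (ω (e' - c')) (by linarith) (hg.mono hsub) (hω0 _)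
      (fun z u hu hut hz hzb => by
        rw [hω]
        exact forwardDifferenceBound_modulusOfSmoothness k _ hg z u hu hut
          ((hac.trans hcc).trans hz) (hzb.trans (hee.trans heb)))
    have hω' : W₀ * ω (e' - c') ≤ W₀ * ω (e - c) :=
      mul_le_mul_of_nonneg_left (hmono (by linarith)) hW₀
    have hD : ∀ w ∈ Icc c' e', |(Q' - Q).eval w| ≤ 2 * (W₀ * ω (e - c)) := by
      intro w hw
      have h1 := abs_le.1 (hQ w ⟨hcc.trans hw.1, hw.2.trans hee⟩)
      have h2 := abs_le.1 ((hQ' w hw).trans hω')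
      rw [eval_sub, abs_le]
      constructor <;> linarith [h1.1, h1.2, h2.1, h2.2]
    have h1 := hmk (Q' - Q) c' e' _ ((degree_sub_le _ _).trans_lt (max_lt hQ'deg hQdeg))
      (by linarith) hD x hx' y hy'
    have h2 := ih c' e' (hac.trans hcc) (hee.trans heb) (by linarith)
      (by rw [hlen]; rw [pow_succ] at hed; linarith) hx' hy' Q' hQ'deg hQ'
    -- Markov on the half interval: replacing `Q'` by `Q` costs one dyadic piece, the integral from
    -- `e - c` to `2(e - c)`.
    have h3 : K * (|x - y| / (e' - c')) * (2 * (W₀ * ω (e - c))) ≤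
        16 * W₀ * K * (d * ∫ t in (e - c)..2 * (e - c), ω t / t ^ 2) := by
      have h4 : |x - y| / (e' - c') ≤ d / ((e - c) / 2) := by rw [hlen]; gcongr
      calc K * (|x - y| / (e' - c')) * (2 * (W₀ * ω (e - c)))
          ≤ K * (d / ((e - c) / 2)) * (2 * (W₀ * ω (e - c))) := by
            have := hω0 (e - c)
            gcongr
        _ = K * (W₀ * ω (e - c) * (d / (e - c)) * 4) := by field_simp; ring
        _ ≤ K * (16 * W₀ * (d * ∫ t in (e - c)..2 * (e - c), ω t / t ^ 2)) :=
            mul_le_mul_of_nonneg_left (hlarge c e hde) hK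
        _ = _ := by ring
    have hsplit := integral_div_sq_split hmono hd hde (by linarith : e - c ≤ 2 * (e - c))
    have h5 : 0 ≤ 16 * W₀ * (d * ∫ t in (e - c)..2 * (e - c), ω t / t ^ 2) :=
      mul_nonneg (by positivity) (mul_nonneg hd.le (integral_div_sq_nonneg hω0 (by linarith)))
    -- The integral from the induction ends where this piece begins, so the pieces add up without
    -- overlap.
    rw [show 2 * (e' - c') = e - c by linarith] at h2
    calc |(g x - Q.eval x) - (g y - Q.eval y)|
        = |((g x - Q'.eval x) - (g y - Q'.eval y)) + ((Q' - Q).eval x - (Q' - Q).eval y)| := by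
          rw [eval_sub, eval_sub]
          congr 1
          ring
      _ ≤ 16 * W₀ * (1 + K) * (d * ∫ t in d..(e - c), ω t / t ^ 2) +
          16 * W₀ * K * (d * ∫ t in (e - c)..2 * (e - c), ω t / t ^ 2) :=
          (abs_add_le _ _).trans (add_le_add h2 (h1.trans h3))
      _ ≤ _ := by
          rw [hsplit]
          linarith

theorem abs_sub_sub_le_integral {k : ℕ} {W₀ K : ℝ} (hW₀ : 0 ≤ W₀)
    (hwh : IsWhitneyConstant k W₀) (hK : 0 ≤ K) (hmk : IsMarkovConstant k K) {g : ℝ → ℝ} {a b : ℝ}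
    (hg : ContinuousOn g (Icc a b)) {ω : ℝ → ℝ} (hω : ∀ t, ω t = modulusOfSmoothness k g t a b)
    {d x y : ℝ} (hd : 0 < d) (hdab : d ≤ b - a) (hxy : |x - y| ≤ d) (hx : x ∈ Icc a b)
    (hy : y ∈ Icc a b) {Q : ℝ[X]} (hQdeg : Q.degree < k)
    (hQ : ∀ w ∈ Icc a b, |g w - Q.eval w| ≤ W₀ * ω (b - a)) :
    |(g x - Q.eval x) - (g y - Q.eval y)| ≤
      16 * W₀ * (1 + K) * (d * ∫ t in d..2 * (b - a), ω t / t ^ 2) := by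
  obtain ⟨n, hn⟩ := pow_unbounded_of_one_lt ((b - a) / d) one_lt_two
  exact abs_sub_sub_le_integral_of_le_pow hW₀ hwh hK hmk hg hω hd hxy n a b le_rfl le_rfl hdab
    ((div_le_iff₀ hd).1 hn.le) hx hy Q hQdeg hQ

/-! ### Hermite interpolation: existence, uniqueness and stability -/

/-- Every node is a root of multiplicity at least `r + 1`, which makes more roots than the degree
allows. -/
theorem eq_zero_of_iterate_derivative_eval_eq_zero {r μ : ℕ} {z : Fin (μ + 1) → ℝ}
    (hz : Function.Injective z) {p : ℝ[X]} (hp : p.degree < (((r + 1) * (μ + 1) : ℕ) : WithBot ℕ))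
    (h : ∀ ν, ∀ j ≤ r, (derivative^[j] p).eval (z ν) = 0) : p = 0 := by
  by_contra h0
  have hle : (r + 1) • (Finset.univ.val.map z) ≤ p.roots := by
    rw [Multiset.le_iff_count]
    intro x
    rw [Multiset.count_nsmul]
    have hnodup : (Finset.univ.val.map z).Nodup := Finset.univ.nodup.map hz
    by_cases hx : x ∈ Finset.univ.val.map z
    · obtain ⟨ν, -, rfl⟩ := Multiset.mem_map.1 hx
      rw [Multiset.count_eq_one_of_mem hnodup hx, count_roots, mul_one]
      exact (lt_rootMultiplicity_iff_isRoot_iterate_derivative h0).2 fun j hj => h ν j hj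
    · rw [Multiset.count_eq_zero_of_notMem hx]
      simp
  have h1 := (Multiset.card_le_card hle).trans (card_roots' p)
  have h2 := (natDegree_lt_iff_degree_lt h0).2 hp
  rw [Multiset.card_nsmul] at h1
  simp at h1
  omega

/-- The Hermite data map is linear and injective between spaces of equal dimension, hence
surjective. -/
theorem exists_polynomial_iterate_derivative_eval_eq {r μ : ℕ} {z : Fin (μ + 1) → ℝ}
    (hz : Function.Injective z) (d : Fin (μ + 1) → ℕ → ℝ) :
    ∃ p : ℝ[X], p.degree < (((r + 1) * (μ + 1) : ℕ) : WithBot ℕ) ∧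
      ∀ ν, ∀ j ≤ r, (derivative^[j] p).eval (z ν) = d ν j := by
  set M := (r + 1) * (μ + 1) with hM
  let T : degreeLT ℝ M →ₗ[ℝ] (Fin (μ + 1) × Fin (r + 1) → ℝ) :=
    { toFun := fun p i => (derivative^[i.2] (p : ℝ[X])).eval (z i.1)
      map_add' := fun p q => by
        funext i
        simp
      map_smul' := fun c p => by
        funext i
        simp [iterate_derivative_smul] }
  have hTinj : Function.Injective T := by
    rw [← LinearMap.ker_eq_bot, LinearMap.ker_eq_bot']
    intro p hp
    refine Subtype.ext (eq_zero_of_iterate_derivative_eval_eq_zero hz (mem_degreeLT.1 p.2) ?_)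
    intro ν j hj
    exact congrFun hp (ν, ⟨j, by omega⟩)
  have : FiniteDimensional ℝ (degreeLT ℝ M) := (degreeLTEquiv ℝ M).symm.finiteDimensional
  have hrank : Module.finrank ℝ (degreeLT ℝ M) =
      Module.finrank ℝ (Fin (μ + 1) × Fin (r + 1) → ℝ) := by
    rw [(degreeLTEquiv ℝ M).finrank_eq]
    simp [hM, mul_comm]
  obtain ⟨p, hp⟩ := (LinearMap.injective_iff_surjective_of_finrank_eq_finrank hrank).1 hTinj
    fun i => d i.1 i.2
  exact ⟨p, mem_degreeLT.1 p.2, fun ν j hj => congrFun hp (ν, ⟨j, by omega⟩)⟩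

theorem existsUnique_isHermitePolynomial {r μ : ℕ} {z : Fin (μ + 1) → ℝ}
    (hz : Function.Injective z) (f : ℝ → ℝ) : ∃! L : ℝ[X], IsHermitePolynomial r μ z f L := by
  obtain ⟨L, hdeg, hL⟩ := exists_polynomial_iterate_derivative_eval_eq (r := r) hz
    fun ν j => iteratedDerivWithin j f (Icc (z 0) (z (Fin.last μ))) (z ν)
  refine ⟨L, ⟨hdeg, hL⟩, fun P hP => sub_eq_zero.1
    (eq_zero_of_iterate_derivative_eval_eq_zero (r := r) hz
      ((degree_sub_le _ _).trans_lt (max_lt hP.1 hdeg)) fun ν j hj => ?_)⟩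
  rw [iterate_derivative_sub, eval_sub, hP.2 ν j hj, hL ν j hj, sub_self]

/-- The value at `x` of the `j`-th derivative of the polynomial with coefficients `c`. -/
noncomputable def evalDerivOfCoeffs {M : ℕ} (c : Fin M → ℝ) (j : ℕ) (x : ℝ) : ℝ :=
  ∑ i : Fin M, c i * (derivative^[j] (X ^ (i : ℕ) : ℝ[X])).eval x

theorem eval_iterate_derivative_sum_coeffs {M : ℕ} (c : Fin M → ℝ) (j : ℕ) (x : ℝ) :
    (derivative^[j] (∑ i : Fin M, C (c i) * X ^ (i : ℕ) : ℝ[X])).eval x =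
      evalDerivOfCoeffs c j x := by
  rw [iterate_derivative_sum, eval_finsetSum, evalDerivOfCoeffs]
  simp only [iterate_derivative_C_mul, eval_mul, eval_C]

theorem eval_iterate_derivative_eq_evalDerivOfCoeffs {M : ℕ} {p : ℝ[X]} (hp : p.degree < M)
    (j : ℕ) (x : ℝ) :
    (derivative^[j] p).eval x = evalDerivOfCoeffs (fun i : Fin M => p.coeff i) j x := by
  by_cases h0 : p = 0
  · simp [h0, evalDerivOfCoeffs]
  rw [← eval_iterate_derivative_sum_coeffs,
    Fin.sum_univ_eq_sum_range (fun i => C (p.coeff i) * X ^ i) M,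
    ← as_sum_range_C_mul_X_pow' p ((natDegree_lt_iff_degree_lt h0).2 hp)]

theorem evalDerivOfCoeffs_smul {M : ℕ} (s : ℝ) (c : Fin M → ℝ) (j : ℕ) (x : ℝ) :
    evalDerivOfCoeffs (s • c) j x = s * evalDerivOfCoeffs c j x := by
  simp only [evalDerivOfCoeffs, Pi.smul_apply, smul_eq_mul, mul_assoc, Finset.mul_sum]

theorem continuous_evalDerivOfCoeffs {Y : Type*} [TopologicalSpace Y] {M : ℕ}
    {c : Y → Fin M → ℝ} {x : Y → ℝ} (hc : Continuous c) (hx : Continuous x) (j : ℕ) :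
    Continuous fun y => evalDerivOfCoeffs (c y) j (x y) := by
  unfold evalDerivOfCoeffs
  refine continuous_finsetSum _ fun i _ => ?_
  exact ((continuous_apply i).comp hc).mul ((Polynomial.continuous _).comp hx)

/-- A polynomial with bounded Hermite data at separated nodes of `[0, 1]` has bounded
coefficients. -/
theorem exists_norm_coeffs_le (r μ : ℕ) {lam : ℝ} (hlam : 0 < lam) :
    ∃ B : ℝ, 0 ≤ B ∧ ∀ (z : Fin (μ + 1) → ℝ) (c : Fin ((r + 1) * (μ + 1)) → ℝ) (D : ℝ),
      (∀ ν, z ν ∈ Icc (0 : ℝ) 1) → (∀ j : Fin μ, lam ≤ z j.succ - z j.castSucc) →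
      (∀ ν, ∀ j ≤ r, |evalDerivOfCoeffs c j (z ν)| ≤ D) → ‖c‖ ≤ B * D := by
  set M := (r + 1) * (μ + 1) with hM
  set S : Set (Fin (μ + 1) → ℝ) :=
    {z | (∀ ν, z ν ∈ Icc (0 : ℝ) 1) ∧ ∀ j : Fin μ, lam ≤ z j.succ - z j.castSucc} with hS
  have hScompact : IsCompact S := by
    refine (isCompact_univ_pi (s := fun _ : Fin (μ + 1) => Icc (0 : ℝ) 1)
      fun _ => isCompact_Icc).of_isClosed_subset ?_ fun z hz ν _ => hz.1 ν
    have heq : S = (⋂ ν, (fun z => z ν) ⁻¹' Icc (0 : ℝ) 1) ∩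
        ⋂ j : Fin μ, {z | lam ≤ z j.succ - z j.castSucc} := by
      ext z
      simp [hS]
    rw [heq]
    exact (isClosed_iInter fun ν => isClosed_Icc.preimage (continuous_apply ν)).inter
      (isClosed_iInter fun j => isClosed_le continuous_const (by fun_prop))
  set Φ : (Fin (μ + 1) → ℝ) × (Fin M → ℝ) → ℝ := fun q =>
    ∑ ν, ∑ j ∈ Finset.range (r + 1), |evalDerivOfCoeffs q.2 j (q.1 ν)| with hΦ
  have hΦcont : Continuous Φ := by
    refine continuous_finsetSum _ fun ν _ => continuous_finsetSum _ fun j _ => ?_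
    exact (continuous_evalDerivOfCoeffs continuous_snd
      ((continuous_apply ν).comp continuous_fst) j).abs
  -- The total size of the Hermite data is continuous in nodes and coefficients jointly. It is
  -- positive on separated nodes times the unit sphere, because separated nodes are distinct;
  -- compactness gives a positive lower bound `ε`.
  obtain ⟨ε, hε, hle⟩ := (hScompact.prod (isCompact_sphere (0 : Fin M → ℝ) 1)).exists_forall_le'
    hΦcont.continuousOn (a := 0) (fun q hq => by
      have hnn : 0 ≤ Φ q := Finset.sum_nonneg fun ν _ => Finset.sum_nonneg fun j _ => abs_nonneg _
      refine hnn.lt_of_ne fun h0 => ?_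
      have hzero : ∀ ν, ∀ j ≤ r, evalDerivOfCoeffs q.2 j (q.1 ν) = 0 := by
        intro ν j hj
        have h1 := (Finset.sum_eq_zero_iff_of_nonneg
          fun ν _ => Finset.sum_nonneg fun j _ => abs_nonneg _).1 h0.symm ν (Finset.mem_univ ν)
        exact abs_eq_zero.1 ((Finset.sum_eq_zero_iff_of_nonneg fun j _ => abs_nonneg _).1 h1 j
          (Finset.mem_range.2 (by omega)))
      have hinj : Function.Injective q.1 := (Fin.strictMono_iff_lt_succ.2 fun j => by
        linarith [hq.1.2 j]).injective
      have hp : (∑ i : Fin M, C (q.2 i) * X ^ (i : ℕ) : ℝ[X]) = 0 := by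
        refine eq_zero_of_iterate_derivative_eval_eq_zero (r := r) hinj ?_ fun ν j hj => ?_
        · exact degree_sum_fin_lt q.2
        · rw [eval_iterate_derivative_sum_coeffs, hzero ν j hj]
      have hc : q.2 = 0 := by
        funext i
        have := congrArg (fun p => coeff p i) hp
        simpa [finsetSum_coeff, coeff_C_mul, coeff_X_pow, Fin.val_inj] using this
      have hq2 : ‖q.2‖ = 1 := by simpa using hq.2
      rw [hc, norm_zero] at hq2
      exact zero_ne_one hq2)
  refine ⟨M / ε, by positivity, fun z c D hz hsep hD => ?_⟩
  have hD0 : 0 ≤ D := (abs_nonneg _).trans (hD 0 0 (Nat.zero_le r))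
  by_cases hc : c = 0
  · rw [hc, norm_zero]
    positivity
  have hcpos : 0 < ‖c‖ := norm_pos_iff.2 hc
  have h1 := hle (z, ‖c‖⁻¹ • c) ⟨⟨hz, hsep⟩, by simp [norm_smul, hcpos.ne']⟩
  have h2 : Φ (z, ‖c‖⁻¹ • c) = ‖c‖⁻¹ * Φ (z, c) := by
    simp only [hΦ, evalDerivOfCoeffs_smul, abs_mul, Finset.mul_sum, abs_of_pos (inv_pos.2 hcpos)]
  have h3 : Φ (z, c) ≤ M * D := by
    calc Φ (z, c) ≤ ∑ _ν : Fin (μ + 1), ∑ _j ∈ Finset.range (r + 1), D :=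
          Finset.sum_le_sum fun ν _ => Finset.sum_le_sum fun j hj =>
            hD ν j (Nat.lt_succ_iff.1 (Finset.mem_range.1 hj))
      _ = M * D := by
          simp only [Finset.sum_const, Finset.card_univ, Fintype.card_fin, Finset.card_range,
            nsmul_eq_mul, hM]
          push_cast
          ring
  rw [h2, inv_mul_eq_div, le_div_iff₀ hcpos] at h1
  rw [div_mul_eq_mul_div, le_div_iff₀ hε]
  linarith

theorem exists_iterate_derivative_bound_unit (r μ : ℕ) {lam : ℝ} (hlam : 0 < lam) :
    ∃ B : ℝ, 0 ≤ B ∧ ∀ (z : Fin (μ + 1) → ℝ) (p : ℝ[X]) (D : ℝ),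
      p.degree < (((r + 1) * (μ + 1) : ℕ) : WithBot ℕ) →
      (∀ ν, z ν ∈ Icc (0 : ℝ) 1) → (∀ j : Fin μ, lam ≤ z j.succ - z j.castSucc) →
      (∀ ν, ∀ j ≤ r, |(derivative^[j] p).eval (z ν)| ≤ D) →
      ∀ x ∈ Icc (0 : ℝ) 1, |(derivative^[r] p).eval x| ≤ B * D := by
  obtain ⟨B, hB, h⟩ := exists_norm_coeffs_le r μ hlam
  choose A hA using fun i : ℕ => isCompact_Icc.exists_bound_of_continuousOn
    (s := Icc (0 : ℝ) 1) (f := fun x => (derivative^[r] (X ^ i : ℝ[X])).eval x) (by fun_prop)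
  have hA0 : ∀ i, 0 ≤ A i := fun i => (norm_nonneg _).trans (hA i 0 (by simp))
  refine ⟨B * ∑ i : Fin ((r + 1) * (μ + 1)), A i,
    mul_nonneg hB (Finset.sum_nonneg fun i _ => hA0 i),
    fun z p D hp hz hsep hD x hx => ?_⟩
  have hc := h z (fun i => p.coeff i) D hz hsep fun ν j hj => by
    rw [← eval_iterate_derivative_eq_evalDerivOfCoeffs hp]
    exact hD ν j hj
  rw [eval_iterate_derivative_eq_evalDerivOfCoeffs hp, evalDerivOfCoeffs, mul_right_comm,
    Finset.mul_sum]
  refine (Finset.abs_sum_le_sum_abs _ _).trans (Finset.sum_le_sum fun i _ => ?_)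
  rw [abs_mul]
  exact mul_le_mul ((norm_le_pi_norm (fun i : Fin _ => p.coeff i) i).trans hc) (hA i x hx)
    (abs_nonneg _) ((norm_nonneg _).trans hc)

theorem iterate_derivative_comp_affine (p : ℝ[X]) (c l : ℝ) (j : ℕ) :
    derivative^[j] (p.comp (C c + C l * X)) =
      C (l ^ j) * (derivative^[j] p).comp (C c + C l * X) := by
  induction j with
  | zero => simp
  | succ j ih =>
    rw [Function.iterate_succ_apply', ih, Function.iterate_succ_apply', derivative_C_mul,
      derivative_comp, pow_succ, C_mul]
    simp
    ring

/-- The scale-invariant form of the bound on the `r`-th derivative of a polynomial in terms of its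
Hermite data at nodes of `[a, b]` with relative separation `lam`. -/
theorem exists_iterate_derivative_bound (r μ : ℕ) {lam : ℝ} (hlam : 0 < lam) :
    ∃ B : ℝ, 0 ≤ B ∧ ∀ (a b : ℝ) (z : Fin (μ + 1) → ℝ) (p : ℝ[X]) (E : ℝ), a < b →
      p.degree < (((r + 1) * (μ + 1) : ℕ) : WithBot ℕ) →
      (∀ ν, z ν ∈ Icc a b) → (∀ j : Fin μ, lam * (b - a) ≤ z j.succ - z j.castSucc) →
      (∀ ν, ∀ j ≤ r, |(derivative^[j] p).eval (z ν)| ≤ E * (b - a) ^ (r - j)) →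
      ∀ x ∈ Icc a b, |(derivative^[r] p).eval x| ≤ B * E := by
  obtain ⟨B, hB, h⟩ := exists_iterate_derivative_bound_unit r μ hlam
  refine ⟨B, hB, fun a b z p E hab hp hz hsep hE x hx => ?_⟩
  have hl : 0 < b - a := sub_pos.2 hab
  have hmem : ∀ z ∈ Icc a b, (z - a) / (b - a) ∈ Icc (0 : ℝ) 1 := fun z hz =>
    ⟨div_nonneg (by linarith [hz.1]) hl.le, (div_le_one hl).2 (by linarith [hz.2])⟩
  have hback : ∀ z, a + (b - a) * ((z - a) / (b - a)) = z := fun z => by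
    rw [mul_div_cancel₀ _ hl.ne', add_sub_cancel]
  have hval : ∀ j w, (derivative^[j] (p.comp (C a + C (b - a) * X))).eval ((w - a) / (b - a)) =
      (b - a) ^ j * (derivative^[j] p).eval w := fun j w => by
    rw [iterate_derivative_comp_affine, eval_mul, eval_C, eval_comp_affine, hback]
  -- Rescaling multiplies a `j`-th derivative by `(b - a)^j`, so all the data become bounded by `E
  -- (b - a)^r`.
  have key := h (fun ν => (z ν - a) / (b - a)) (p.comp (C a + C (b - a) * X)) (E * (b - a) ^ r)
    (degree_comp_affine_lt hp _ _) (fun ν => hmem _ (hz ν))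
    (fun j => by
      rw [← sub_div, le_div_iff₀ hl, sub_sub_sub_cancel_right]
      exact hsep j)
    (fun ν j hj => by
      rw [hval, abs_mul, abs_of_pos (pow_pos hl j)]
      calc (b - a) ^ j * |(derivative^[j] p).eval (z ν)|
          ≤ (b - a) ^ j * (E * (b - a) ^ (r - j)) := by
            have := hE ν j hj
            gcongr
        _ = E * (b - a) ^ r := by rw [mul_left_comm, ← pow_add, Nat.add_sub_cancel' hj])
    _ (hmem x hx)
  rw [hval, abs_mul, abs_of_pos (pow_pos hl r)] at key
  have hlr := pow_pos hl r
  nlinarith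

/-! ### The interpolation error and the integral -/

theorem hasDerivWithinAt_iteratedDerivWithin {f : ℝ → ℝ} {a b : ℝ} (hab : a < b) {r : ℕ}
    (hf : ContDiffOn ℝ (r : ℕ) f (Icc a b)) {j : ℕ} (hj : j < r) {x : ℝ} (hx : x ∈ Icc a b) :
    HasDerivWithinAt (iteratedDerivWithin j f (Icc a b)) (iteratedDerivWithin (j + 1) f (Icc a b) x)
      (Icc a b) x := by
  rw [iteratedDerivWithin_succ]
  exact (hf.differentiableOn_iteratedDerivWithin (by exact_mod_cast hj) (uniqueDiffOn_Icc hab) x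
    hx).hasDerivWithinAt

theorem degree_iterate_derivative_lt {p : ℝ[X]} {M : ℕ} (hp : p.degree < M) {r : ℕ} (hr : r < M) :
    (derivative^[r] p).degree < ((M - r : ℕ) : WithBot ℕ) := by
  by_cases h0 : derivative^[r] p = 0
  · rw [h0, degree_zero]
    exact WithBot.bot_lt_coe _
  have hp0 : p ≠ 0 := by
    rintro rfl
    simp at h0
  rw [← natDegree_lt_iff_degree_lt h0]
  have h1 := (natDegree_lt_iff_degree_lt hp0).2 hp
  have h2 := natDegree_iterate_derivative p r
  omega

/-- The error of Hermite interpolation at a point at distance `δ` from a node. -/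
theorem exists_hermite_error_bound (r μ : ℕ) {lam : ℝ} (hlam : 0 < lam) :
    ∃ C : ℝ, 0 ≤ C ∧ ∀ (z : Fin (μ + 1) → ℝ) (a b : ℝ), a < b → a = z 0 → b = z (Fin.last μ) →
      (∀ ν, z ν ∈ Icc a b) → (∀ j : Fin μ, lam * (b - a) ≤ z j.succ - z j.castSucc) →
      ∀ f : ℝ → ℝ, ContDiffOn ℝ (r : ℕ) f (Icc a b) → ∀ ω : ℝ → ℝ,
      (∀ t, ω t = modulusOfSmoothness ((r + 1) * (μ + 1) - r)
        (iteratedDerivWithin r f (Icc a b)) t a b) →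
      ∀ L : ℝ[X], IsHermitePolynomial r μ z f L → ∀ x ∈ Icc a b, ∀ ν, ∀ δ, 0 < δ → δ ≤ b - a →
        |x - z ν| = δ →
        |f x - L.eval x| ≤ C * (δ ^ (r + 1) * ∫ t in δ..2 * (b - a), ω t / t ^ 2) := by
  set k := (r + 1) * (μ + 1) - r with hk
  have hrM : r < (r + 1) * (μ + 1) := by nlinarith
  have hk1 : 1 ≤ k := by omega
  have hkr : k + r = (r + 1) * (μ + 1) := by omega
  obtain ⟨W₀, hW₀, hwh⟩ := exists_isWhitneyConstant hk1
  obtain ⟨K, hK, hmk⟩ := exists_isMarkovConstant hk1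
  obtain ⟨B, hB, hherm⟩ := exists_iterate_derivative_bound r μ hlam
  refine ⟨16 * W₀ * (1 + K) + 4 * K * B * W₀, by positivity, ?_⟩
  intro z a b hab ha hb hz hsep f hf ω hω L hL x hx ν δ hδ hδab hxν
  have hl : 0 < b - a := sub_pos.2 hab
  set G : ℕ → ℝ → ℝ := fun j => iteratedDerivWithin j f (Icc a b) with hG
  have hchain : ∀ j < r, ∀ x ∈ Icc a b, HasDerivWithinAt (G j) (G (j + 1) x) (Icc a b) x :=
    fun j hj x hx => hasDerivWithinAt_iteratedDerivWithin hab hf hj hx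
  have hGr : ContinuousOn (G r) (Icc a b) :=
    hf.continuousOn_iteratedDerivWithin le_rfl (uniqueDiffOn_Icc hab)
  have hLG : ∀ ν, ∀ j ≤ r, (derivative^[j] L).eval (z ν) = G j (z ν) := fun ν j hj => by
    rw [hL.2 ν j hj, ← ha, ← hb]
  have hmono : Monotone ω := by
    have := modulusOfSmoothness_mono k hGr
    rwa [← funext hω] at this
  have hω0 : ∀ t, 0 ≤ ω t := fun t => by
    rw [hω]
    exact modulusOfSmoothness_nonneg _ _ _ _ _
  obtain ⟨Q, hQdeg, hQ⟩ := hwh (G r) a b (ω (b - a)) hab hGr (hω0 _) (by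
    rw [hω]
    exact forwardDifferenceBound_modulusOfSmoothness k _ hGr)
  set E := W₀ * ω (b - a) with hE
  have hE0 : 0 ≤ E := mul_nonneg hW₀ (hω0 _)
  obtain ⟨P, hPdeg, hPder, hP⟩ := exists_polynomial_approx_of_chain (convex_Icc a b) hchain
    (left_mem_Icc.2 hab.le) hQdeg hQ
  rw [hkr] at hPdeg
  have hLP : (L - P).degree < (((r + 1) * (μ + 1) : ℕ) : WithBot ℕ) :=
    (degree_sub_le _ _).trans_lt (max_lt hL.1 hPdeg)
  -- At the nodes `L` has the data of `f`, so the data of `L - P` are the approximation errors of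
  -- `P`; stability carries their size to the whole interval.
  have hp : ∀ y ∈ Icc a b, |(derivative^[r] (L - P)).eval y| ≤ B * E := by
    refine hherm a b z (L - P) E hab hLP hz hsep fun ν j hj => ?_
    rw [iterate_derivative_sub, eval_sub, hLG ν j hj]
    refine (hP j hj _ (hz ν)).trans ?_
    have : |z ν - a| ≤ b - a := by
      rw [abs_of_nonneg (by linarith [(hz ν).1])]
      linarith [(hz ν).2]
    gcongr
  set J := ∫ t in δ..2 * (b - a), ω t / t ^ 2 with hJ
  have hωJ : ω (b - a) / (4 * (b - a)) ≤ J := by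
    refine (div_le_integral_div_sq hmono hω0 hl).trans ?_
    rw [hJ, integral_div_sq_split hmono hδ hδab (by linarith)]
    linarith [integral_div_sq_nonneg hω0 hδab]
  have hR : ∀ y ∈ Icc a b ∩ Metric.closedBall (z ν) δ,
      |G r y - (derivative^[r] L).eval y| ≤
        (16 * W₀ * (1 + K) + 4 * K * B * W₀) * (δ * J) := by
    intro y hy
    have hyν : |y - z ν| ≤ δ := by simpa [Real.dist_eq] using hy.2
    have h1 := abs_sub_sub_le_integral hW₀ hwh hK hmk hGr hω hδ hδab hyν hy.1 (hz ν) hQdeg hQ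
    have h2 := hmk _ a b _ (degree_iterate_derivative_lt hLP hrM) hab hp y hy.1 (z ν) (hz ν)
    have h3 : K * (|y - z ν| / (b - a)) * (B * E) ≤ 4 * K * B * W₀ * (δ * J) := by
      calc K * (|y - z ν| / (b - a)) * (B * E) ≤ K * (δ / (b - a)) * (B * E) := by gcongr
        _ = 4 * K * B * W₀ * (δ * (ω (b - a) / (4 * (b - a)))) := by
          rw [hE]
          field_simp
        _ ≤ _ := by gcongr
    -- Uses `f^(r)(z_ν) = L^(r)(z_ν)` and `P^(r) = Q`.
    have h4 : G r y - (derivative^[r] L).eval y =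
        ((G r y - Q.eval y) - (G r (z ν) - Q.eval (z ν))) -
          ((derivative^[r] (L - P)).eval y - (derivative^[r] (L - P)).eval (z ν)) := by
      rw [iterate_derivative_sub, eval_sub, eval_sub, hPder, hLG ν r le_rfl]
      ring
    rw [h4, add_mul]
    exact (abs_sub _ _).trans (add_le_add h1 (h2.trans h3))
  have hzmem : z ν ∈ Icc a b ∩ Metric.closedBall (z ν) δ :=
    ⟨hz ν, Metric.mem_closedBall_self hδ.le⟩
  have hxmem : x ∈ Icc a b ∩ Metric.closedBall (z ν) δ := ⟨hx, by simp [Real.dist_eq, hxν]⟩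
  -- The derivatives of `f - L` of order below `r` vanish at `z_ν`; integrating from there gains the
  -- factor `δ^r`.
  have hfin := abs_le_mul_pow_of_chain (r := r)
    (G := fun j y => G j y - (derivative^[j] L).eval y)
    ((convex_Icc a b).inter (convex_closedBall (z ν) δ))
    (fun j hj y hy => ((hchain j hj y hy.1).mono inter_subset_left).sub
      (hasDerivWithinAt_iterate_derivative L j _ y)) hzmem
    (fun j hj => sub_eq_zero.2 (hLG ν j hj.le).symm) hR (Nat.zero_le r) x hxmem
  simp only [hG, iteratedDerivWithin_zero, Function.iterate_zero, id, Nat.sub_zero, hxν] at hfin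
  refine hfin.trans (le_of_eq ?_)
  ring

/-! ### From the integral to the modulus, and the theorem -/

theorem integral_one_div_sq_le {s t : ℝ} (hs : 0 < s) (hst : s ≤ t) :
    ∫ τ in s..t, 1 / τ ^ 2 ≤ 1 / s := by
  have hpos : ∀ τ ∈ uIcc s t, τ ≠ 0 := fun τ hτ => by
    rw [uIcc_of_le hst] at hτ
    exact (hs.trans_le hτ.1).ne'
  have h := intervalIntegral.integral_eq_sub_of_hasDerivAt (a := s) (b := t)
    (f := fun τ : ℝ => -τ⁻¹) (f' := fun τ => 1 / τ ^ 2)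
    (fun τ hτ => by
      have := (hasDerivAt_inv (hpos τ hτ)).neg
      rwa [neg_neg, ← one_div] at this)
    (ContinuousOn.intervalIntegrable
      (ContinuousOn.div (by fun_prop) (by fun_prop) fun τ hτ => pow_ne_zero 2 (hpos τ hτ)))
  rw [h]
  have : 0 < t⁻¹ := inv_pos.2 (hs.trans_le hst)
  rw [one_div]
  linarith

/-- Splitting the integral at `s` with `s ^ k = l ^ (k - 1) * δ`. -/
theorem mul_integral_div_sq_le {k : ℕ} (hk : 2 ≤ k) {ω : ℝ → ℝ} (hω : Monotone ω)
    (hω0 : ∀ t, 0 ≤ ω t)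
    (hpow : ∀ s t : ℝ, 0 < s → s ≤ t → ω t ≤ (2 * t / s) ^ k * ω s) {δ l : ℝ} (hδ : 0 < δ)
    (hδl : δ ≤ l) :
    δ * ∫ t in δ..2 * l, ω t / t ^ 2 ≤ (1 + 4 ^ k) * ω (l * (δ / l) ^ (1 / (k : ℝ))) := by
  have hl : 0 < l := hδ.trans_le hδl
  have hq0 : 0 < δ / l := div_pos hδ hl
  have hq1 : δ / l ≤ 1 := (div_le_one hl).2 hδl
  have hk1 : (1 : ℝ) ≤ k := by exact_mod_cast (by omega : 1 ≤ k)
  set s := l * (δ / l) ^ (1 / (k : ℝ)) with hs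
  have hspow : s ^ k = l ^ k * (δ / l) := by
    rw [hs, mul_pow, one_div, Real.rpow_inv_natCast_pow hq0.le (by omega)]
  have hδs : δ ≤ s := by
    have h1 : δ / l ≤ (δ / l) ^ (1 / (k : ℝ)) := by
      conv_lhs => rw [← Real.rpow_one (δ / l)]
      exact Real.rpow_le_rpow_of_exponent_ge hq0 hq1 ((div_le_one (by positivity)).2 hk1)
    calc δ = l * (δ / l) := by field_simp
      _ ≤ s := by rw [hs]; gcongr
  have hsl : s ≤ l := mul_le_of_le_one_right hl.le (Real.rpow_le_one hq0.le hq1 (by positivity))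
  have hs0 : 0 < s := hδ.trans_le hδs
  have hωs := hω0 s
  have hleft : ∫ t in δ..s, ω t / t ^ 2 ≤ ω s * (1 / δ) := by
    have hint : IntervalIntegrable (fun t : ℝ => ω s * (1 / t ^ 2)) volume δ s := by
      refine ContinuousOn.intervalIntegrable (ContinuousOn.mul (by fun_prop)
        (ContinuousOn.div (by fun_prop) (by fun_prop) fun τ hτ => ?_))
      rw [uIcc_of_le hδs] at hτ
      exact pow_ne_zero 2 (hδ.trans_le hτ.1).ne'
    refine (intervalIntegral.integral_mono_on hδs (intervalIntegrable_div_sq hω hδ hδs) hint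
      fun t ht => ?_).trans ?_
    · rw [mul_one_div]
      have := hω ht.2
      gcongr
    · rw [intervalIntegral.integral_const_mul]
      exact mul_le_mul_of_nonneg_left (integral_one_div_sq_le hδ hδs) hωs
  have hright : ∫ t in s..2 * l, ω t / t ^ 2 ≤ 4 ^ k * ω s * (1 / δ) := by
    obtain ⟨n, rfl⟩ := Nat.exists_eq_add_of_le' hk
    -- After `ω(t) ≤ (2t/s)^k ω(s)` the integrand contains `t^(k-2)`; since `k ≥ 2` it is largest at
    -- `2l`. With `s^k = l^(k-1) δ` this yields `4^k / 2 · ω(s) / δ`.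
    have hle : s ≤ 2 * l := by linarith
    refine (intervalIntegral.integral_mono_on hle (intervalIntegrable_div_sq hω hs0 hle)
      (g := fun _ => 2 ^ (n + 2) * (2 * l) ^ n / s ^ (n + 2) * ω s) (by simp)
      fun t ht => ?_).trans ?_
    · have ht0 : 0 < t := hs0.trans_le ht.1
      calc ω t / t ^ 2 ≤ (2 * t / s) ^ (n + 2) * ω s / t ^ 2 := by
            have := hpow s t hs0 ht.1
            gcongr
        _ = 2 ^ (n + 2) * t ^ n / s ^ (n + 2) * ω s := by
            rw [div_pow, mul_pow]
            field_simp
            ring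
        _ ≤ _ := by
            have := ht.2
            gcongr
    · rw [intervalIntegral.integral_const, smul_eq_mul, hspow]
      calc (2 * l - s) * (2 ^ (n + 2) * (2 * l) ^ n / (l ^ (n + 2) * (δ / l)) * ω s)
          ≤ 2 * l * (2 ^ (n + 2) * (2 * l) ^ n / (l ^ (n + 2) * (δ / l)) * ω s) := by
            refine mul_le_mul_of_nonneg_right (by linarith) (by positivity)
        _ = 4 ^ (n + 2) / 2 * ω s * (1 / δ) := by
            rw [show (4 : ℝ) = 2 * 2 by norm_num, mul_pow, mul_pow]
            field_simp
            ring
        _ ≤ 4 ^ (n + 2) * ω s * (1 / δ) := by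
            have : (4 : ℝ) ^ (n + 2) / 2 ≤ 4 ^ (n + 2) := half_le_self (by positivity)
            gcongr
  rw [integral_div_sq_split hω hδ hδs (by linarith)]
  calc δ * ((∫ t in δ..s, ω t / t ^ 2) + ∫ t in s..2 * l, ω t / t ^ 2)
      ≤ δ * (ω s * (1 / δ) + 4 ^ k * ω s * (1 / δ)) := by gcongr
    _ = (1 + 4 ^ k) * ω s := by field_simp

theorem corollary5 (m : ℕ) (lam : ℝ) (hlam0 : 0 < lam) (hlam1 : lam ≤ 1) :
    ∃ C₁ C₂ C₃ : ℝ, 0 < C₁ ∧ 0 < C₂ ∧ 0 < C₃ ∧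
      ∀ (r μ : ℕ), 1 ≤ μ → m = (r + 1) * (μ + 1) →
      ∀ (z : Fin (μ + 1) → ℝ), StrictMono z →
      ∀ (a b : ℝ), a = z 0 → b = z (Fin.last μ) →
      (∀ j : Fin μ, lam * (b - a) ≤ z j.succ - z j.castSucc) →
      ∀ f : ℝ → ℝ, ContDiffOn ℝ (r : ℕ) f (Set.Icc a b) →
      ∀ ω : ℝ → ℝ,
        (∀ t, ω t = modulusOfSmoothness (m - r) (iteratedDerivWithin r f (Set.Icc a b)) t a b) →
        (∃! L : Polynomial ℝ, IsHermitePolynomial r μ z f L) ∧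
        ∀ L : Polynomial ℝ, IsHermitePolynomial r μ z f L →
        ∀ x ∈ Set.Icc a b, ∀ δ : ℝ, δ = Metric.infDist x (Set.range z) →
          (0 < δ → IntervalIntegrable (fun t => ω t / t ^ 2) MeasureTheory.volume
            δ (2 * (b - a))) ∧
          |f x - L.eval x| ≤ C₁ * (δ ^ (r + 1) * ∫ t in δ..(2 * (b - a)), ω t / t ^ 2) ∧
          C₁ * (δ ^ (r + 1) * ∫ t in δ..(2 * (b - a)), ω t / t ^ 2) ≤
            C₂ * (δ ^ r * ω ((b - a) * (δ / (b - a)) ^ (1 / ((m : ℝ) - (r : ℝ))))) ∧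
          C₂ * (δ ^ r * ω ((b - a) * (δ / (b - a)) ^ (1 / ((m : ℝ) - (r : ℝ))))) ≤
            C₃ * (δ ^ r * ω (b - a)) := by
  choose C hC0 hC using fun r μ : ℕ => exists_hermite_error_bound r μ hlam0
  -- The constants may depend only on `m` and `lam`, so sum over all `r, μ ≤ m`; the `1` ensures
  -- positivity.
  set C₁ : ℝ := 1 + ∑ r ∈ Finset.range (m + 1), ∑ μ ∈ Finset.range (m + 1), C r μ with hC₁
  have hsum0 : 0 ≤ ∑ r ∈ Finset.range (m + 1), ∑ μ ∈ Finset.range (m + 1), C r μ :=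
    Finset.sum_nonneg fun r _ => Finset.sum_nonneg fun μ _ => hC0 r μ
  have hC₁pos : 0 < C₁ := by linarith
  refine ⟨C₁, C₁ * (1 + 4 ^ m), C₁ * (1 + 4 ^ m), hC₁pos, by positivity, by positivity, ?_⟩
  intro r μ hμ hm z hzmono a b ha hb hsep f hf ω hω
  have hab : a < b := by
    rw [ha, hb]
    exact hzmono (Fin.lt_def.2 (by simpa using Nat.lt_of_succ_le hμ))
  have hl : 0 < b - a := sub_pos.2 hab
  have hz : ∀ ν, z ν ∈ Icc a b := fun ν =>
    ⟨ha ▸ hzmono.monotone (Fin.zero_le ν), hb ▸ hzmono.monotone (Fin.le_last ν)⟩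
  have hrm : r + 2 ≤ m := by rw [hm]; nlinarith
  have hμm : μ ≤ m := by rw [hm]; nlinarith
  have hCle : C r μ ≤ C₁ := by
    have h1 := Finset.single_le_sum (f := fun μ => C r μ) (fun μ _ => hC0 r μ)
      (Finset.mem_range.2 (by omega : μ < m + 1))
    have h2 := Finset.single_le_sum (f := fun r => ∑ μ ∈ Finset.range (m + 1), C r μ)
      (fun r _ => Finset.sum_nonneg fun μ _ => hC0 r μ)
      (Finset.mem_range.2 (by omega : r < m + 1))
    linarith
  have hGr : ContinuousOn (iteratedDerivWithin r f (Icc a b)) (Icc a b) :=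
    hf.continuousOn_iteratedDerivWithin le_rfl (uniqueDiffOn_Icc hab)
  have hmono : Monotone ω := by
    have := modulusOfSmoothness_mono (m - r) hGr
    rwa [← funext hω] at this
  have hω0 : ∀ t, 0 ≤ ω t := fun t => by
    rw [hω]
    exact modulusOfSmoothness_nonneg _ _ _ _ _
  have hωpow : ∀ s t : ℝ, 0 < s → s ≤ t → ω t ≤ (2 * t / s) ^ (m - r) * ω s := fun s t hs hst => by
    rw [hω, hω]
    exact modulusOfSmoothness_le_pow (m - r) hGr hs hst
  refine ⟨existsUnique_isHermitePolynomial hzmono.injective f, fun L hL x hx δ hδ => ?_⟩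
  have hδ0 : 0 ≤ δ := hδ ▸ Metric.infDist_nonneg
  have hδl : δ ≤ b - a := by
    have h1 := Metric.infDist_le_dist_of_mem (x := x) (mem_range_self (f := z) 0)
    rw [← hδ, Real.dist_eq, ← ha, abs_of_nonneg (by linarith [hx.1])] at h1
    linarith [hx.2]
  obtain ⟨_, ⟨ν, rfl⟩, hν⟩ :=
    (finite_range z).isCompact.exists_infDist_eq_dist (range_nonempty z) x
  rw [← hδ, Real.dist_eq] at hν
  have hcast : (m : ℝ) - r = ((m - r : ℕ) : ℝ) := by rw [Nat.cast_sub (by omega)]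
  have hk0 : (0 : ℝ) < ((m - r : ℕ) : ℝ) := by exact_mod_cast (by omega : 0 < m - r)
  have hexp : 0 < 1 / ((m : ℝ) - r) := by
    rw [hcast]
    positivity
  have hthird : C₁ * (1 + 4 ^ m) * (δ ^ r * ω ((b - a) * (δ / (b - a)) ^ (1 / ((m : ℝ) - r)))) ≤
      C₁ * (1 + 4 ^ m) * (δ ^ r * ω (b - a)) := by
    have h1 : ω ((b - a) * (δ / (b - a)) ^ (1 / ((m : ℝ) - r))) ≤ ω (b - a) :=
      hmono (mul_le_of_le_one_right hl.le
        (Real.rpow_le_one (by positivity) ((div_le_one hl).2 hδl) hexp.le))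
    gcongr
  rcases hδ0.eq_or_lt with h0 | hδpos
  · have hxz : x = z ν := by
      rw [← h0] at hν
      exact sub_eq_zero.1 (abs_eq_zero.1 hν.symm)
    have hfL : L.eval x = f x := by
      have := hL.2 ν 0 (Nat.zero_le r)
      rwa [iteratedDerivWithin_zero, ← hxz] at this
    -- For `δ = 0` the point is a node, and `δ ^ (r + 1) = 0` annihilates whatever value the
    -- integral has.
    refine ⟨fun h => absurd h (by rw [← h0]; exact lt_irrefl _), ?_, ?_, hthird⟩
    · rw [hfL, ← h0]
      simp
    · have h1 := hω0 ((b - a) * (δ / (b - a)) ^ (1 / ((m : ℝ) - r)))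
      rw [show δ ^ (r + 1) = 0 by rw [← h0]; simp, zero_mul, mul_zero]
      positivity
  · have hint := intervalIntegrable_div_sq hmono hδpos (by linarith : δ ≤ 2 * (b - a))
    have hJ := integral_div_sq_nonneg hω0 (by linarith : δ ≤ 2 * (b - a))
    refine ⟨fun _ => hint, ?_, ?_, hthird⟩
    · refine (hC r μ z a b hab ha hb hz hsep f hf ω (hm ▸ hω) L hL x hx ν δ hδpos hδl
        hν.symm).trans ?_
      gcongr
    · have h1 := mul_integral_div_sq_le (by omega : 2 ≤ m - r) hmono hω0 hωpow hδpos hδl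
      rw [hcast, mul_assoc C₁]
      refine mul_le_mul_of_nonneg_left ?_ hC₁pos.le
      have h2 := hω0 ((b - a) * (δ / (b - a)) ^ (1 / ((m - r : ℕ) : ℝ)))
      calc δ ^ (r + 1) * ∫ t in δ..2 * (b - a), ω t / t ^ 2
          = δ ^ r * (δ * ∫ t in δ..2 * (b - a), ω t / t ^ 2) := by ring
        _ ≤ δ ^ r * ((1 + 4 ^ (m - r)) *
              ω ((b - a) * (δ / (b - a)) ^ (1 / ((m - r : ℕ) : ℝ)))) := by gcongr
        _ ≤ δ ^ r * ((1 + 4 ^ m) *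
              ω ((b - a) * (δ / (b - a)) ^ (1 / ((m - r : ℕ) : ℝ)))) := by
            have : (4 : ℝ) ^ (m - r) ≤ 4 ^ m := pow_le_pow_right₀ (by norm_num) (Nat.sub_le _ _)
            gcongr
        _ = _ := by ring
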